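/- Let $(\Omega,\mathcal F,(\mathcal F_t)_{t\ge 0},P)$ be a filtered probability space and let $X=(X_t)_{t\ge 0}$ be a spectrally negative Lévy process on it. That is, $X$ is real-valued and adapted, has càdlàg paths, $X_0=0$ a.s., for $0\le s\le t$ the increment $X_t-X_s$ is independent of $\mathcal F_s$ and distributed as $X_{t-s}$, the Lévy measure $\Pi$ of $X$ satisfies $\Pi(0,\infty)=0$, and the paths of $X$ are not almost surely monotone (neither almost surely non-decreasing nor almost surely non-increasing). Here $\Pi$ is the measure on $\mathbb R\setminus\{0\}$ with $\int(1\wedge x^2)\,\Pi(dx)<\infty$ in the Lévy–Khintchine representation $E(e^{i\theta X_t})=e^{-t\Psi(\theta)}$, $\Psi(\theta)=i\mu\theta+\tfrac{\sigma^2}{2}\theta^2+\int\bigl(1-e^{i\theta x}+i\theta x\mathbf 1_{|x|<1}\bigr)\Pi(dx)$, $\theta\in\mathbb R$, $t\ge 0$, with $\mu,\sigma\in\mathbb R$. For $\lambda\ge 0$ let $\psi(\lambda)=\log E(e^{\lambda X_1})$ be the Laplace exponent of $X$, and for $q\ge 0$ let $\Phi(q)=\sup\{\lambda\ge 0:\psi(\lambda)=q\}$.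 These are well defined: $E(e^{\lambda X_t})=e^{\psi(\lambda)t}<\infty$ for all $\lambda,t\ge 0$, and $\Phi(q)$ is the largest root in $[0,\infty)$ of $\psi(\lambda)=q$. Then for every $q\ge 0$ the $q$-scale function of $X$ exists: there is a unique function $W^{(q)}:\mathbb R\to[0,\infty)$ such that $W^{(q)}(x)=0$ for $x<0$, $W^{(q)}$ is right-continuous on $[0,\infty)$, and for every $\beta>\Phi(q)$ $$\int_0^\infty e^{-\beta x}\,W^{(q)}(x)\,dx=\frac{1}{\psi(\beta)-q},$$ the integral being finite. -/

import Mathlib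

open MeasureTheory ProbabilityTheory Filter Topology
open scoped NNReal

/-- `X` is a real-valued Lévy process on the filtered probability space `(Ω, mΩ, ℱ, P)`:
it is adapted, starts at `0`, has càdlàg paths, and for `s ≤ t` the increment `X t - X s`
is independent of `ℱ s` and has the law of `X (t - s)`.

Neither completeness nor right-continuity of the filtration is required, and the strong Markov
property is not listed because it is a consequence of the other properties. -/
structure IsLevyProcess {Ω : Type*} {mΩ : MeasurableSpace Ω} (X : ℝ≥0 → Ω → ℝ)
    (ℱ : Filtration ℝ≥0 mΩ) (P : Measure Ω) : Prop where
  adapted : ∀ t, Measurable[ℱ t] (X t)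
  start_zero : ∀ᵐ ω ∂P, X 0 ω = 0
  cadlag : ∀ᵐ ω ∂P, ∀ t : ℝ≥0,
    ContinuousWithinAt (fun s => X s ω) (Set.Ici t) t ∧
      ∃ l : ℝ, Tendsto (fun s => X s ω) (𝓝[<] t) (𝓝 l)
  indep_increment : ∀ s t, s ≤ t →
    Indep (MeasurableSpace.comap (fun ω => X t ω - X s ω) inferInstance) (ℱ s) P
  stationary_increment : ∀ s t, s ≤ t →
    IdentDistrib (fun ω => X t ω - X s ω) (X (t - s)) P P

/-- A Lévy measure: a measure on `ℝ \ {0}` (as a measure on `ℝ` without mass at `0`) with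
`∫ (1 ∧ x²) Π(dx) < ∞`. -/
structure IsLevyMeasure (Lm : Measure ℝ) : Prop where
  zero_mass : Lm {0} = 0
  integral_lt_top : ∫⁻ x, ENNReal.ofReal (min 1 (x ^ 2)) ∂Lm < ⊤

/-- The Lévy–Khintchine exponent of the triplet `(μ, σ, Π)`:
`Ψ(θ) = iμθ + σ²θ²/2 + ∫ (1 - e^{iθx} + iθx 1_{|x|<1}) Π(dx)`. -/
noncomputable def levyKhintchineExponent (μ σ : ℝ) (Lm : Measure ℝ) (θ : ℝ) : ℂ :=
  Complex.I * μ * θ + (σ : ℂ) ^ 2 / 2 * (θ : ℂ) ^ 2 +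
    ∫ x : ℝ, (1 - Complex.exp (Complex.I * θ * x)
      + Complex.I * θ * ((if |x| < 1 then x else 0 : ℝ) : ℂ)) ∂Lm

/-- `X` has Lévy triplet `(μ, σ, Π)`: `Π` is a Lévy measure and `E e^{iθ X_t} = e^{-tΨ(θ)}` for
all `t ≥ 0` and real `θ`. (Every Lévy process has exactly one `(μ, σ², Π)`.) -/
structure HasLevyTriplet {Ω : Type*} {mΩ : MeasurableSpace Ω} (X : ℝ≥0 → Ω → ℝ)
    (P : Measure Ω) (μ σ : ℝ) (Lm : Measure ℝ) : Prop where
  levyMeasure : IsLevyMeasure Lm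
  charFun_eq : ∀ (t : ℝ≥0) (θ : ℝ),
    charFun (P.map (X t)) θ = Complex.exp (-((t : ℝ) : ℂ) * levyKhintchineExponent μ σ Lm θ)

/-- `X` is a spectrally negative Lévy process: a Lévy process whose Lévy measure is carried by
`(-∞, 0)` and whose paths are not monotone. -/
structure IsSpectrallyNegativeLevyProcess {Ω : Type*} {mΩ : MeasurableSpace Ω}
    (X : ℝ≥0 → Ω → ℝ) (ℱ : Filtration ℝ≥0 mΩ) (P : Measure Ω) : Prop where
  isLevy : IsLevyProcess X ℱ P
  no_positive_jumps : ∃ (μ σ : ℝ) (Lm : Measure ℝ),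
    HasLevyTriplet X P μ σ Lm ∧ Lm (Set.Ioi 0) = 0
  not_increasing : ¬ ∀ᵐ ω ∂P, Monotone (fun t => X t ω)
  not_decreasing : ¬ ∀ᵐ ω ∂P, Antitone (fun t => X t ω)

/-- The Laplace exponent `ψ(u) = log E e^{u X_1}`. -/
noncomputable def laplaceExponent {Ω : Type*} {mΩ : MeasurableSpace Ω} (X : ℝ≥0 → Ω → ℝ)
    (P : Measure Ω) (u : ℝ) : ℝ :=
  cgf (X 1) P u

/-- `Φ(q) = sup {u ≥ 0 : ψ(u) = q}`. -/
noncomputable def laplaceExponentInverse {Ω : Type*} {mΩ : MeasurableSpace Ω}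
    (X : ℝ≥0 → Ω → ℝ) (P : Measure Ω) (q : ℝ) : ℝ :=
  sSup {u : ℝ | 0 ≤ u ∧ laplaceExponent X P u = q}

/-- The properties that define the `q`-scale function of `X`: it is a function
`W : ℝ → [0, ∞)` that vanishes on `(-∞, 0)`, is right-continuous on `[0, ∞)`, and satisfies
`∫₀^∞ e^{-βx} W(x) dx = 1 / (ψ(β) - q)` (a convergent integral) for all `β > Φ(q)`. -/
structure IsScaleFunction {Ω : Type*} {mΩ : MeasurableSpace Ω} (X : ℝ≥0 → Ω → ℝ)
    (P : Measure Ω) (q : ℝ) (W : ℝ → ℝ) : Prop where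
  nonneg : ∀ x, 0 ≤ W x
  eq_zero : ∀ x, x < 0 → W x = 0
  right_continuous : ∀ x, 0 ≤ x → ContinuousWithinAt W (Set.Ici x) x
  integrable : ∀ β, laplaceExponentInverse X P q < β →
    IntegrableOn (fun x => Real.exp (-β * x) * W x) (Set.Ioi 0) volume
  laplace_eq : ∀ β, laplaceExponentInverse X P q < β →
    ∫ x in Set.Ioi (0 : ℝ), Real.exp (-β * x) * W x = 1 / (laplaceExponent X P β - q)

/-!
The proof is analytic: the process enters only through the one-dimensional laws of `X`, and through
its paths to see that the Laplace exponent `ψ` is positive somewhere.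

**Approximation.** Write `L` for the Lévy measure, which lives on `(-∞, 0)`. Cutting off the jumps
smaller than `1/N` and replacing the Gaussian part by jumps of size `1/N` at rate `σ²N²`, both
compensated by the drift, gives compound Poisson exponents
`κₙ(z) = dₙ z + ∫ (e^{zx} - 1) gₙ(dx)` with finite `gₙ` on `(-∞, 0)`. By dominated convergence they
converge to the Lévy–Khintchine exponent `η` on all of `re z ≥ 0`
(`tendsto_jumpExponent_approx`). This is used twice.

**Exponential moments.** On the imaginary axis the convergence says, by Lévy's continuity theorem,
that the compound Poisson laws converge weakly to the law of `X t`. On the positive half-line it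
says that their exponential moments converge, and weak convergence with bounded moments at `2u`
carries the moments at `u` over to the limit: `E e^{u X_t} = e^{t η(u)}`
(`lintegral_exp_of_charFun`). In particular `ψ = η` on `[0, ∞)`.

**Largest root.** If `ψ ≤ 0` on `[0, ∞)`, Chernoff's bound makes all increments nonpositive and the
paths decreasing, which is excluded; so `ψ > 0` somewhere, and `ψ → ∞` because `ψ(u)/u` is
nondecreasing (Jensen). Since `ψ` is continuous and `ψ(0) = 0`, there is a largest root `Φ(q)`, and
`ψ > q` to the right of it.

**Existence of the scale function.** For a compound Poisson exponent `κ` with drift `d`,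
integration by parts gives `(κ(β) - q)/β = d - ĥ(β)`, where `ĥ` is the Laplace transform of the
positive measure `h(dx) = (q + g(-∞, -x]) dx` on `(0, ∞)`. Hence, wherever `κ(β) > q`,
`β / (κ(β) - q) = ∑ₖ ĥ(β)ᵏ / d^{k+1}` is the Laplace transform of the positive measure
`∑ₖ h^{∗k} / d^{k+1}` (`exists_scaleMeasure_of_jumpExponent`). Given `b > Φ(q)`, eventually
`κₙ(b) > q`, and a compactness argument (`exists_measure_of_tendsto_laplace`) produces a measure `V`
on `[0, ∞)` with Laplace transform `β / (ψ(β) - q)` for `β ≥ b`. Its distribution function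
`W(x) = V[0, x]` is right-continuous with Laplace transform `1 / (ψ(β) - q)`.

**Uniqueness.** The Laplace transform on a half-line `[b, ∞)` determines `W` (`eq_of_laplace_eq`):
after the substitution `y = e^{-x}` this is Weierstrass' approximation theorem. So the functions
built for different `b` coincide, which also extends the transform formula to all `β > Φ(q)`.
-/

namespace LevyScale
open scoped ENNReal

/-! ### Power series of a measure under convolution -/

lemma ae_nonneg_of_Iio_zero {ν : Measure ℝ} (h : ν (Set.Iio 0) = 0) : ∀ᵐ x ∂ν, 0 ≤ x := by
  rw [ae_iff]; simpa [← Set.Iio_def] using h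

lemma ae_neg_of_Ici_zero {ν : Measure ℝ} (h : ν (Set.Ici 0) = 0) : ∀ᵐ x ∂ν, x < 0 := by
  rw [ae_iff]; simpa [← Set.Ici_def] using h

/-- The `k`-fold convolution power of a measure on `ℝ`. -/
noncomputable def convPow (g : Measure ℝ) : ℕ → Measure ℝ
  | 0 => Measure.dirac 0
  | k + 1 => convPow g k ∗ g

/-- The convolution power series `∑ₖ aₖ g^{∗k}`. -/
noncomputable def convSeries (a : ℕ → ℝ≥0∞) (g : Measure ℝ) : Measure ℝ :=
  Measure.sum fun k => a k • convPow g k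

instance sfinite_convPow (g : Measure ℝ) [SFinite g] (k : ℕ) : SFinite (convPow g k) := by
  induction k with
  | zero => unfold convPow; infer_instance
  | succ k ih => unfold convPow; infer_instance

instance isFiniteMeasure_convPow (g : Measure ℝ) [IsFiniteMeasure g] (k : ℕ) :
    IsFiniteMeasure (convPow g k) := by
  induction k with
  | zero => unfold convPow; infer_instance
  | succ k ih => unfold convPow; infer_instance

/-- The integral of a character `f` turns convolution powers into powers. -/
lemma lintegral_convPow (g : Measure ℝ) [SFinite g] {f : ℝ → ℝ≥0∞} (hf : Measurable f)
    (h0 : f 0 = 1) (hadd : ∀ x y, f (x + y) = f x * f y) (k : ℕ) :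
    ∫⁻ x, f x ∂(convPow g k) = (∫⁻ x, f x ∂g) ^ k := by
  induction k with
  | zero => simp [convPow, lintegral_dirac' _ hf, h0]
  | succ k ih =>
    rw [convPow, Measure.lintegral_conv hf, pow_succ, ← ih]
    simp_rw [hadd]
    rw [← lintegral_mul_const _ hf]
    exact lintegral_congr fun x => lintegral_const_mul _ hf

lemma lintegral_convSeries (a : ℕ → ℝ≥0∞) (g : Measure ℝ) [SFinite g] {f : ℝ → ℝ≥0∞}
    (hf : Measurable f) (h0 : f 0 = 1) (hadd : ∀ x y, f (x + y) = f x * f y) :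
    ∫⁻ x, f x ∂(convSeries a g) = ∑' k, a k * (∫⁻ x, f x ∂g) ^ k := by
  simp [convSeries, lintegral_sum_measure, lintegral_smul_measure,
    lintegral_convPow g hf h0 hadd]

lemma lintegral_exp_convSeries (a : ℕ → ℝ≥0∞) (g : Measure ℝ) [SFinite g] (u : ℝ) :
    ∫⁻ x, ENNReal.ofReal (Real.exp (u * x)) ∂(convSeries a g)
      = ∑' k, a k * (∫⁻ x, ENNReal.ofReal (Real.exp (u * x)) ∂g) ^ k := by
  refine lintegral_convSeries a g (by fun_prop) (by simp) fun x y => ?_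
  rw [mul_add, Real.exp_add, ENNReal.ofReal_mul (by positivity)]

lemma convPow_Iio_zero (g : Measure ℝ) [SFinite g] (hg : g (Set.Iio 0) = 0) (k : ℕ) :
    convPow g k (Set.Iio 0) = 0 := by
  induction k with
  | zero => simp [convPow]
  | succ k ih =>
    rw [convPow, ← lintegral_indicator_one measurableSet_Iio,
      Measure.lintegral_conv (measurable_one.indicator measurableSet_Iio)]
    have h1 : ∀ᵐ x ∂(convPow g k), 0 ≤ x := ae_nonneg_of_Iio_zero ih
    have h2 : ∀ᵐ x ∂g, 0 ≤ x := ae_nonneg_of_Iio_zero hg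
    rw [lintegral_eq_zero_of_ae_eq_zero]
    filter_upwards [h1] with x hx
    refine lintegral_eq_zero_of_ae_eq_zero ?_
    filter_upwards [h2] with y hy
    simp [add_nonneg hx hy]

lemma convSeries_Iio_zero (a : ℕ → ℝ≥0∞) (g : Measure ℝ) [SFinite g]
    (hg : g (Set.Iio 0) = 0) : convSeries a g (Set.Iio 0) = 0 := by
  simp [convSeries, Measure.sum_apply _ measurableSet_Iio, convPow_Iio_zero g hg]

lemma charFun_convPow (g : Measure ℝ) [IsFiniteMeasure g] (θ : ℝ) (k : ℕ) :
    charFun (convPow g k) θ = charFun g θ ^ k := by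
  induction k with
  | zero => simp [convPow]
  | succ k ih => rw [convPow, charFun_conv, ih, pow_succ]

/-! ### Compound Poisson laws with drift -/

/-- The compound Poisson law with jump measure `g`: `e^{-|g|} ∑ₖ g^{∗k} / k!`. -/
noncomputable def compoundPoisson (g : Measure ℝ) : Measure ℝ :=
  convSeries (fun k => ENNReal.ofReal (Real.exp (-g.real Set.univ) / k.factorial)) g

lemma lintegral_exp_compoundPoisson (g : Measure ℝ) [IsFiniteMeasure g] {u r : ℝ} (hr : 0 ≤ r)
    (hu : ∫⁻ x, ENNReal.ofReal (Real.exp (u * x)) ∂g = ENNReal.ofReal r) :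
    ∫⁻ x, ENNReal.ofReal (Real.exp (u * x)) ∂(compoundPoisson g)
      = ENNReal.ofReal (Real.exp (r - g.real Set.univ)) := by
  rw [compoundPoisson, lintegral_exp_convSeries, hu]
  have hs : HasSum (fun k : ℕ => Real.exp (-g.real Set.univ) * (r ^ k / k.factorial))
      (Real.exp (-g.real Set.univ) * Real.exp r) := by
    rw [Real.exp_eq_exp_ℝ]
    exact (NormedSpace.expSeries_div_hasSum_exp r).mul_left _
  rw [show r - g.real Set.univ = -g.real Set.univ + r by ring, Real.exp_add, ← hs.tsum_eq,
    ENNReal.ofReal_tsum_of_nonneg (fun k => by positivity) hs.summable]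
  refine tsum_congr fun k => ?_
  rw [← ENNReal.ofReal_pow hr, ← ENNReal.ofReal_mul (by positivity)]
  congr 1
  ring

instance isProbabilityMeasure_compoundPoisson (g : Measure ℝ) [IsFiniteMeasure g] :
    IsProbabilityMeasure (compoundPoisson g) := by
  constructor
  simpa using lintegral_exp_compoundPoisson g (u := 0) (r := g.real Set.univ)
    measureReal_nonneg (by simp)

lemma charFun_compoundPoisson (g : Measure ℝ) [IsFiniteMeasure g] (θ : ℝ) :
    charFun (compoundPoisson g) θ = Complex.exp (charFun g θ - g.real Set.univ) := by
  have hint : Integrable (fun x : ℝ => Complex.exp (θ * x * Complex.I)) (compoundPoisson g) := by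
    refine (integrable_const (1 : ℝ)).mono (by fun_prop) (ae_of_all _ fun x => ?_)
    simp [Complex.norm_exp]
  have h1 := hasSum_integral_measure hint
  have h2 : HasSum (fun k : ℕ => Complex.exp (-(g.real Set.univ : ℂ))
      * (charFun g θ ^ k / k.factorial)) (Complex.exp (-(g.real Set.univ : ℂ))
        * Complex.exp (charFun g θ)) := by
    rw [Complex.exp_eq_exp_ℂ]
    exact (NormedSpace.expSeries_div_hasSum_exp (charFun g θ)).mul_left _
  rw [charFun_apply_real, sub_eq_neg_add, Complex.exp_add]
  refine h1.unique (h2.congr_fun ?_)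
  intro k
  rw [integral_smul_measure, ← charFun_apply_real, charFun_convPow,
    ENNReal.toReal_ofReal (by positivity)]
  rw [Complex.real_smul]
  push_cast
  ring

/-- The compound Poisson law with jump measure `g`, shifted by `d`. -/
noncomputable def driftCompoundPoisson (d : ℝ) (g : Measure ℝ) : Measure ℝ :=
  (compoundPoisson g).map (fun x => x + d)

instance isProbabilityMeasure_driftCompoundPoisson (d : ℝ) (g : Measure ℝ) [IsFiniteMeasure g] :
    IsProbabilityMeasure (driftCompoundPoisson d g) :=
  Measure.isProbabilityMeasure_map (by fun_prop)

/-- The exponent `d z + ∫ (e^{zx} - 1) g(dx)` of a compound Poisson process with drift. -/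
noncomputable def jumpExponent (d : ℝ) (g : Measure ℝ) (z : ℂ) : ℂ :=
  d * z + ∫ x : ℝ, (Complex.exp (z * x) - 1) ∂g

lemma charFun_driftCompoundPoisson (d : ℝ) (g : Measure ℝ) [IsFiniteMeasure g] (θ : ℝ) :
    charFun (driftCompoundPoisson d g) θ
      = Complex.exp (jumpExponent d g (Complex.I * θ)) := by
  have hint : Integrable (fun x : ℝ => Complex.exp (Complex.I * θ * x)) g := by
    refine (integrable_const (1 : ℝ)).mono (by fun_prop) (ae_of_all _ fun x => ?_)
    simp [Complex.norm_exp]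
  rw [driftCompoundPoisson, charFun_map_add_const, charFun_compoundPoisson, jumpExponent,
    integral_sub hint (integrable_const _), ← Complex.exp_add, charFun_apply_real]
  congr 1
  simp only [integral_const, Complex.real_smul, mul_one]
  have : ∀ x : ℝ, (θ : ℂ) * x * Complex.I = Complex.I * θ * x := fun x => by ring
  simp_rw [this]
  simp
  ring

/-- The real exponent `d u + ∫ (e^{ux} - 1) g(dx)` of a compound Poisson process with drift. -/
noncomputable def realJumpExponent (d : ℝ) (g : Measure ℝ) (u : ℝ) : ℝ :=
  d * u + ∫ x : ℝ, (Real.exp (u * x) - 1) ∂g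

lemma jumpExponent_ofReal (d : ℝ) (g : Measure ℝ) (u : ℝ) :
    jumpExponent d g u = realJumpExponent d g u := by
  rw [jumpExponent, realJumpExponent]
  push_cast
  congr 1
  rw [← integral_complex_ofReal]
  push_cast
  rfl

lemma lintegral_exp_driftCompoundPoisson (d : ℝ) (g : Measure ℝ) [IsFiniteMeasure g]
    (u : ℝ) (hu : Integrable (fun x => Real.exp (u * x)) g) :
    ∫⁻ x, ENNReal.ofReal (Real.exp (u * x)) ∂(driftCompoundPoisson d g)
      = ENNReal.ofReal (Real.exp (realJumpExponent d g u)) := by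
  rw [driftCompoundPoisson, lintegral_map (by fun_prop) (by fun_prop)]
  simp_rw [mul_add, Real.exp_add, ENNReal.ofReal_mul (Real.exp_pos _).le]
  rw [lintegral_mul_const _ (by fun_prop), lintegral_exp_compoundPoisson g
    (r := ∫ x, Real.exp (u * x) ∂g) (integral_nonneg fun _ => (Real.exp_pos _).le),
    ← ENNReal.ofReal_mul (by positivity), ← Real.exp_add, realJumpExponent,
    integral_sub hu (integrable_const _)]
  · congr 2
    simp
    ring
  · rw [ofReal_integral_eq_lintegral_ofReal hu (ae_of_all _ fun _ => (Real.exp_pos _).le)]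

/-! ### Compound Poisson approximation of the Lévy–Khintchine exponent -/

/-- The Lévy–Khintchine exponent as a function of `z` with `0 ≤ re z`, for a Lévy measure on the
negative half-line: `E e^{z X_t} = e^{t η(z)}`. -/
noncomputable def complexExponent (μ σ : ℝ) (L : Measure ℝ) (z : ℂ) : ℂ :=
  -μ * z + (σ : ℂ) ^ 2 / 2 * z ^ 2 +
    ∫ x : ℝ, (Complex.exp (z * x) - 1 - z * ((if |x| < 1 then x else 0 : ℝ) : ℂ)) ∂L

lemma complexExponent_I_mul (μ σ : ℝ) (L : Measure ℝ) (θ : ℝ) :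
    complexExponent μ σ L (Complex.I * θ) = -levyKhintchineExponent μ σ L θ := by
  rw [complexExponent, levyKhintchineExponent, neg_add, ← integral_neg]
  congr 1
  · rw [mul_pow, Complex.I_sq]; ring
  · congr 1; ext x; ring

lemma norm_exp_sub_one_sub_id_le_of_re_nonpos {w : ℂ} (hw : w.re ≤ 0) :
    ‖Complex.exp w - 1 - w‖ ≤ 3 * ‖w‖ ^ 2 := by
  rcases le_total ‖w‖ 1 with h | h
  · exact (Complex.norm_exp_sub_one_sub_id_le h).trans (by nlinarith [sq_nonneg ‖w‖])
  · have h1 : ‖Complex.exp w‖ ≤ 1 := by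
      rw [Complex.norm_exp]; exact Real.exp_le_one_iff.2 hw
    calc ‖Complex.exp w - 1 - w‖ ≤ ‖Complex.exp w‖ + ‖(1 : ℂ)‖ + ‖w‖ :=
          (norm_sub_le _ _).trans (by gcongr; exact norm_sub_le _ _)
      _ ≤ 1 + 1 + ‖w‖ := by simpa using h1
      _ ≤ 3 * ‖w‖ ^ 2 := by nlinarith

lemma norm_compensated_exp_le {z : ℂ} (hz : 0 ≤ z.re) {x : ℝ} (hx : x ≤ 0) :
    ‖Complex.exp (z * x) - 1 - z * ((if |x| < 1 then x else 0 : ℝ) : ℂ)‖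
      ≤ (3 * ‖z‖ ^ 2 + 2) * min 1 (x ^ 2) := by
  have hre : (z * x).re ≤ 0 := by
    simpa using mul_nonpos_of_nonneg_of_nonpos hz hx
  split_ifs with h
  · have hx2 : x ^ 2 ≤ 1 := (sq_le_one_iff_abs_le_one x).2 h.le
    rw [min_eq_right hx2]
    refine (norm_exp_sub_one_sub_id_le_of_re_nonpos hre).trans ?_
    rw [norm_mul, Complex.norm_real, Real.norm_eq_abs, mul_pow, sq_abs]
    nlinarith [sq_nonneg x]
  · have hx2 : 1 ≤ x ^ 2 := (one_le_sq_iff_one_le_abs x).2 (not_lt.1 h)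
    rw [min_eq_left hx2]
    have h1 : ‖Complex.exp (z * x)‖ ≤ 1 := by
      rw [Complex.norm_exp]; exact Real.exp_le_one_iff.2 hre
    calc ‖Complex.exp (z * x) - 1 - z * ((0 : ℝ) : ℂ)‖ = ‖Complex.exp (z * x) - 1‖ := by simp
      _ ≤ ‖Complex.exp (z * x)‖ + ‖(1 : ℂ)‖ := norm_sub_le _ _
      _ ≤ (3 * ‖z‖ ^ 2 + 2) * 1 := by
        rw [norm_one]; nlinarith [sq_nonneg ‖z‖]

lemma _root_.IsLevyMeasure.integrable {L : Measure ℝ} (hL : IsLevyMeasure L) :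
    Integrable (fun x : ℝ => min 1 (x ^ 2)) L :=
  (lintegral_ofReal_ne_top_iff_integrable (by fun_prop)
    (ae_of_all _ fun x => by positivity)).1 hL.integral_lt_top.ne

lemma _root_.IsLevyMeasure.measure_Iic_lt_top {L : Measure ℝ} (hL : IsLevyMeasure L) {ε : ℝ}
    (hε : 0 < ε) : L (Set.Iic (-ε)) < ⊤ := by
  refine lt_of_le_of_lt (measure_mono fun x hx => ?_)
    (hL.integrable.measure_ge_lt_top (ε := min 1 (ε ^ 2)) (by positivity))
  have hx' : x ≤ -ε := hx
  exact min_le_min le_rfl ((pow_le_pow_left₀ hε.le (by linarith) 2).trans_eq (neg_sq x))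

/-- The `n`-th approximating jump measure: the jumps of size at least `1/(n+1)`, together with
jumps of size exactly `1/(n+1)` at a rate that makes them imitate the Gaussian part. -/
noncomputable def approxMeasure (σ : ℝ) (L : Measure ℝ) (n : ℕ) : Measure ℝ :=
  L.restrict (Set.Iic (-(1 / (n + 1 : ℝ)))) +
    ENNReal.ofReal (σ ^ 2 * (n + 1) ^ 2) • Measure.dirac (-(1 / (n + 1 : ℝ)))

/-- The `n`-th approximating drift, which compensates the jumps of `approxMeasure`. -/
noncomputable def approxDrift (μ σ : ℝ) (L : Measure ℝ) (n : ℕ) : ℝ :=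
  -μ + σ ^ 2 * (n + 1) -
    ∫ x in Set.Iic (-(1 / (n + 1 : ℝ))), (if |x| < 1 then x else 0 : ℝ) ∂L

lemma isFiniteMeasure_approxMeasure {L : Measure ℝ} (hL : IsLevyMeasure L) (σ : ℝ) (n : ℕ) :
    IsFiniteMeasure (approxMeasure σ L n) := by
  have h : Fact (L (Set.Iic (-(1 / (n + 1 : ℝ)))) < ⊤) :=
    ⟨hL.measure_Iic_lt_top (by positivity)⟩
  have h2 : IsFiniteMeasure (ENNReal.ofReal (σ ^ 2 * (n + 1) ^ 2) •
      Measure.dirac (-(1 / (n + 1 : ℝ)))) := Measure.smul_finite _ ENNReal.ofReal_ne_top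
  unfold approxMeasure
  infer_instance

lemma approxMeasure_Ici_zero (σ : ℝ) (L : Measure ℝ) (n : ℕ) :
    approxMeasure σ L n (Set.Ici 0) = 0 := by
  have h : (0 : ℝ) < 1 / (n + 1) := by positivity
  have h2 : Set.Ici (0 : ℝ) ∩ Set.Iic (-(1 / (n + 1 : ℝ))) = ∅ := by
    ext x; simp only [Set.mem_inter_iff, Set.mem_Ici, Set.mem_Iic, Set.mem_empty_iff_false]
    constructor
    · rintro ⟨h1, h2⟩; linarith
    · exact False.elim
  have h3 : -(1 / (n + 1 : ℝ)) ∉ Set.Ici (0 : ℝ) := by simp only [Set.mem_Ici]; linarith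
  simp only [approxMeasure, Measure.coe_add, Pi.add_apply, Measure.smul_apply,
    Measure.restrict_apply measurableSet_Ici, h2, measure_empty,
    Measure.dirac_apply' _ measurableSet_Ici, Set.indicator_of_notMem h3]
  simp

/-- A rate-`N²` stream of jumps `-1/N`, compensated by a drift, has exponent tending to that of
Brownian motion. -/
lemma tendsto_gaussian_approx (z : ℂ) :
    Tendsto (fun n : ℕ => ((n : ℂ) + 1) * z +
      ((n : ℂ) + 1) ^ 2 * (Complex.exp (z * (-(1 / ((n : ℂ) + 1)))) - 1)) atTop
      (𝓝 (z ^ 2 / 2)) := by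
  rw [tendsto_iff_norm_sub_tendsto_zero]
  have hlim : Tendsto (fun n : ℕ => ‖z‖ ^ 3 * (1 / ((n : ℝ) + 1))) atTop (𝓝 0) := by
    simpa using tendsto_one_div_add_atTop_nhds_zero_nat.const_mul (‖z‖ ^ 3)
  refine squeeze_zero' (Eventually.of_forall fun _ => norm_nonneg _) ?_ hlim
  have hev : ∀ᶠ n : ℕ in atTop, ‖z‖ ≤ n := eventually_atTop.2
    ⟨⌈‖z‖⌉₊, fun n hn => (Nat.le_ceil _).trans (by exact_mod_cast hn)⟩
  filter_upwards [hev] with n hn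
  have hN : (0 : ℝ) < n + 1 := by positivity
  have hN' : ((n : ℂ) + 1) ≠ 0 := by exact_mod_cast hN.ne'
  have hnN : ‖(n : ℂ) + 1‖ = n + 1 := by
    have : (n : ℂ) + 1 = ((n + 1 : ℝ) : ℂ) := by push_cast; rfl
    rw [this, Complex.norm_real, Real.norm_of_nonneg hN.le]
  set w : ℂ := z * (-(1 / ((n : ℂ) + 1))) with hw
  have hwn : ‖w‖ = ‖z‖ / (n + 1) := by
    rw [hw, norm_mul, norm_neg, norm_div, norm_one, hnN]; ring
  have hw1 : ‖w‖ ≤ 1 := by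
    rw [hwn, div_le_one hN]; linarith
  have hb := Complex.exp_bound hw1 (n := 3) (by norm_num)
  have heq : ((n : ℂ) + 1) * z + ((n : ℂ) + 1) ^ 2 * (Complex.exp w - 1) - z ^ 2 / 2
      = ((n : ℂ) + 1) ^ 2 * (Complex.exp w - ∑ m ∈ Finset.range 3, w ^ m / m.factorial) := by
    simp only [Finset.sum_range_succ, Finset.sum_range_zero, Nat.factorial]
    rw [hw]
    field_simp
    push_cast
    ring
  rw [heq, norm_mul, norm_pow, hnN]
  calc ((n : ℝ) + 1) ^ 2 * ‖Complex.exp w - ∑ m ∈ Finset.range 3, w ^ m / m.factorial‖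
      ≤ ((n : ℝ) + 1) ^ 2 * ‖w‖ ^ 3 := by
        gcongr
        refine hb.trans (mul_le_of_le_one_right (by positivity) ?_)
        norm_num [Nat.factorial]
    _ = ‖z‖ ^ 3 * (1 / ((n : ℝ) + 1)) := by
        rw [hwn]; field_simp

lemma jumpExponent_approx {L : Measure ℝ} (hL : IsLevyMeasure L) (μ σ : ℝ) {z : ℂ}
    (hz : 0 ≤ z.re) (n : ℕ) :
    jumpExponent (approxDrift μ σ L n) (approxMeasure σ L n) z =
      -μ * z + (σ : ℂ) ^ 2 * (((n : ℂ) + 1) * z +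
      ((n : ℂ) + 1) ^ 2 * (Complex.exp (z * (-(1 / ((n : ℂ) + 1)))) - 1)) +
      ∫ x, (Set.Iic (-(1 / (n + 1 : ℝ)))).indicator (fun x : ℝ =>
        Complex.exp (z * x) - 1 - z * ((if |x| < 1 then x else 0 : ℝ) : ℂ)) x ∂L := by
  have hfin : Fact (L (Set.Iic (-(1 / (n + 1 : ℝ)))) < ⊤) :=
    ⟨hL.measure_Iic_lt_top (by positivity)⟩
  have hm : Measurable fun x : ℝ => (if |x| < 1 then x else 0 : ℝ) :=
    Measurable.ite (measurableSet_lt (by fun_prop) (by fun_prop)) measurable_id measurable_const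
  have hneg : ∀ᵐ x ∂(L.restrict (Set.Iic (-(1 / (n + 1 : ℝ))))), x ≤ 0 := by
    refine (ae_restrict_mem measurableSet_Iic).mono fun x hx => ?_
    have h0 : (0 : ℝ) < 1 / (n + 1) := by positivity
    have h1 : x ≤ -(1 / (n + 1 : ℝ)) := hx
    linarith
  have hi1 : Integrable (fun x : ℝ => Complex.exp (z * x) - 1)
      (L.restrict (Set.Iic (-(1 / (n + 1 : ℝ))))) := by
    refine Integrable.sub ?_ (integrable_const _)
    refine (integrable_const (1 : ℝ)).mono (by fun_prop) ?_
    filter_upwards [hneg] with x hx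
    rw [Complex.norm_exp, norm_one]
    refine Real.exp_le_one_iff.2 ?_
    simpa using mul_nonpos_of_nonneg_of_nonpos hz hx
  have hi2 : Integrable (fun x : ℝ => (if |x| < 1 then x else 0 : ℝ))
      (L.restrict (Set.Iic (-(1 / (n + 1 : ℝ))))) := by
    refine (integrable_const (1 : ℝ)).mono hm.aestronglyMeasurable (ae_of_all _ fun x => ?_)
    split_ifs with h
    · simpa using h.le
    · simp
  have hi3 : Integrable (fun x : ℝ => z * ((if |x| < 1 then x else 0 : ℝ) : ℂ))
      (L.restrict (Set.Iic (-(1 / (n + 1 : ℝ))))) := hi2.ofReal.const_mul z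
  have hi4 : Integrable (fun x : ℝ => Complex.exp (z * x) - 1)
      (ENNReal.ofReal (σ ^ 2 * (n + 1) ^ 2) • Measure.dirac (-(1 / (n + 1 : ℝ)))) :=
    (integrable_dirac (by simp)).smul_measure ENNReal.ofReal_ne_top
  rw [jumpExponent, approxMeasure, integral_add_measure hi1 hi4, integral_smul_measure,
    integral_dirac, integral_indicator measurableSet_Iic, integral_sub hi1 hi3,
    integral_const_mul, integral_complex_ofReal, approxDrift,
    ENNReal.toReal_ofReal (by positivity), Complex.real_smul]
  push_cast
  ring

lemma tendsto_jumpExponent_approx {L : Measure ℝ} (hL : IsLevyMeasure L)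
    (hpos : L (Set.Ioi 0) = 0) (μ σ : ℝ) {z : ℂ} (hz : 0 ≤ z.re) :
    Tendsto (fun n => jumpExponent (approxDrift μ σ L n) (approxMeasure σ L n) z) atTop
      (𝓝 (complexExponent μ σ L z)) := by
  simp_rw [jumpExponent_approx hL μ σ hz]
  have hm : Measurable fun x : ℝ => (if |x| < 1 then x else 0 : ℝ) :=
    Measurable.ite (measurableSet_lt (by fun_prop) (by fun_prop)) measurable_id measurable_const
  have hneg : ∀ᵐ x ∂L, x < 0 := by
    have h0 : ∀ᵐ x ∂L, x ≠ 0 := by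
      rw [ae_iff]; simpa using hL.zero_mass
    have h1 : ∀ᵐ x ∂L, x ≤ 0 := by
      rw [ae_iff]; simpa [← Set.Ioi_def] using hpos
    filter_upwards [h0, h1] with x hx hx'
    exact lt_of_le_of_ne hx' hx
  rw [complexExponent]
  refine Tendsto.add (Tendsto.add tendsto_const_nhds ?_) ?_
  · convert (tendsto_gaussian_approx z).const_mul ((σ : ℂ) ^ 2) using 2
    ring
  · refine tendsto_integral_of_dominated_convergence
      (fun x => (3 * ‖z‖ ^ 2 + 2) * min 1 (x ^ 2)) ?_ (hL.integrable.const_mul _) ?_ ?_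
    · intro n
      exact (Measurable.aestronglyMeasurable (by fun_prop)).indicator measurableSet_Iic
    · intro n
      filter_upwards [hneg] with x hx
      exact (norm_indicator_le_norm_self _ _).trans (norm_compensated_exp_le hz hx.le)
    · filter_upwards [hneg] with x hx
      refine tendsto_const_nhds.congr' ?_
      have h1 : ∀ᶠ n : ℕ in atTop, 1 / ((n : ℝ) + 1) < -x :=
        tendsto_one_div_add_atTop_nhds_zero_nat.eventually_lt_const (by linarith)
      filter_upwards [h1] with n hn
      rw [Set.indicator_of_mem]
      simp only [Set.mem_Iic]
      linarith

lemma tendsto_realJumpExponent_approx {L : Measure ℝ} (hL : IsLevyMeasure L)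
    (hpos : L (Set.Ioi 0) = 0) (μ σ : ℝ) {u : ℝ} (hu : 0 ≤ u) :
    Tendsto (fun n => realJumpExponent (approxDrift μ σ L n) (approxMeasure σ L n) u) atTop
      (𝓝 (complexExponent μ σ L u).re) := by
  have h := tendsto_jumpExponent_approx hL hpos μ σ (z := u) (by simpa using hu)
  simp_rw [jumpExponent_ofReal] at h
  exact (Complex.continuous_re.tendsto _).comp h

lemma integrable_exp_of_Ici_zero {g : Measure ℝ} [IsFiniteMeasure g] (hg : g (Set.Ici 0) = 0)
    {u : ℝ} (hu : 0 ≤ u) : Integrable (fun x => Real.exp (u * x)) g := by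
  refine (integrable_const (1 : ℝ)).mono (by fun_prop) ?_
  have h1 : ∀ᵐ x ∂g, x < 0 := ae_neg_of_Ici_zero hg
  filter_upwards [h1] with x hx
  rw [Real.norm_of_nonneg (Real.exp_pos _).le, norm_one]
  exact Real.exp_le_one_iff.2 (mul_nonpos_of_nonneg_of_nonpos hu hx.le)

/-! ### Exponential moments of a spectrally negative Lévy process -/

/-- The truncated exponential `x ↦ e^{ux} ∧ K` as a bounded continuous function. -/
noncomputable def truncExp (u : ℝ) (K : ℝ≥0) : BoundedContinuousFunction ℝ ℝ≥0 :=
  BoundedContinuousFunction.mkOfBound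
    ⟨fun x => min (Real.toNNReal (Real.exp (u * x))) K,
      ((continuous_real_toNNReal.comp (by fun_prop)).min continuous_const)⟩ K (by
    intro x y
    rw [NNReal.dist_eq, abs_le]
    have h1 : ((min (Real.toNNReal (Real.exp (u * x))) K : ℝ≥0) : ℝ) ≤ K := by
      exact_mod_cast min_le_right _ _
    have h2 : ((min (Real.toNNReal (Real.exp (u * y))) K : ℝ≥0) : ℝ) ≤ K := by
      exact_mod_cast min_le_right _ _
    have h3 := (min (Real.toNNReal (Real.exp (u * x))) K).coe_nonneg
    have h4 := (min (Real.toNNReal (Real.exp (u * y))) K).coe_nonneg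
    constructor
    · simp only [ContinuousMap.coe_mk]; linarith
    · simp only [ContinuousMap.coe_mk]; linarith)

lemma coe_truncExp (u : ℝ) (K : ℝ≥0) (x : ℝ) :
    ((truncExp u K x : ℝ≥0) : ℝ≥0∞) = min (ENNReal.ofReal (Real.exp (u * x))) K := by
  change ((min (Real.toNNReal (Real.exp (u * x))) K : ℝ≥0) : ℝ≥0∞) = _
  rw [ENNReal.coe_min]; rfl

lemma lintegral_exp_eq_iSup (ν : Measure ℝ) (u : ℝ) :
    ∫⁻ x, ENNReal.ofReal (Real.exp (u * x)) ∂ν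
      = ⨆ k : ℕ, ∫⁻ x, (truncExp u k x : ℝ≥0∞) ∂ν := by
  simp_rw [coe_truncExp]
  rw [← lintegral_iSup (fun k => by fun_prop)]
  · refine lintegral_congr fun x => le_antisymm ?_ (iSup_le fun k => min_le_left _ _)
    obtain ⟨k, hk⟩ := ENNReal.exists_nat_gt (r := ENNReal.ofReal (Real.exp (u * x)))
      ENNReal.ofReal_ne_top
    exact le_iSup_of_le k (le_min le_rfl (by simpa using hk.le))
  · intro i j hij x
    exact min_le_min le_rfl (by simpa using hij)

lemma ofReal_exp_le_truncExp_add (u x : ℝ) {K : ℕ} (hK : 0 < K) :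
    ENNReal.ofReal (Real.exp (u * x)) ≤ (truncExp u K x : ℝ≥0∞) +
      ENNReal.ofReal (1 / K) * ENNReal.ofReal (Real.exp (2 * u * x)) := by
  rw [coe_truncExp]
  rcases le_total (ENNReal.ofReal (Real.exp (u * x))) ((K : ℝ≥0) : ℝ≥0∞) with h | h
  · rw [min_eq_left h]; exact le_self_add
  · refine le_trans ?_ le_add_self
    have hK' : (0 : ℝ) < K := by exact_mod_cast hK
    rw [← ENNReal.ofReal_mul (by positivity)]
    refine ENNReal.ofReal_le_ofReal ?_
    have h' : (K : ℝ) ≤ Real.exp (u * x) := by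
      have : ENNReal.ofReal K ≤ ENNReal.ofReal (Real.exp (u * x)) := by simpa using h
      exact (ENNReal.ofReal_le_ofReal_iff (Real.exp_pos _).le).1 this
    have h2 : Real.exp (2 * u * x) = Real.exp (u * x) * Real.exp (u * x) := by
      rw [← Real.exp_add]; congr 1; ring
    rw [h2, one_div, inv_mul_eq_div, le_div_iff₀ hK']
    exact mul_le_mul_of_nonneg_left h' (Real.exp_pos _).le

/-- Exponential moments pass to a weak limit, because the moments at `2u` are bounded. -/
lemma lintegral_exp_of_tendsto {ν : ℕ → ProbabilityMeasure ℝ} {ν₀ : ProbabilityMeasure ℝ}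
    (hν : Tendsto ν atTop (𝓝 ν₀)) {a : ℕ → ℝ → ℝ} {a₀ : ℝ → ℝ}
    (ha : ∀ u, 0 ≤ u → Tendsto (fun n => a n u) atTop (𝓝 (a₀ u)))
    (hexp : ∀ n u, 0 ≤ u → ∫⁻ x, ENNReal.ofReal (Real.exp (u * x)) ∂(ν n : Measure ℝ)
      = ENNReal.ofReal (Real.exp (a n u))) {u : ℝ} (hu : 0 ≤ u) :
    ∫⁻ x, ENNReal.ofReal (Real.exp (u * x)) ∂(ν₀ : Measure ℝ)
      = ENNReal.ofReal (Real.exp (a₀ u)) := by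
  have hlim : ∀ u, 0 ≤ u → Tendsto (fun n => ENNReal.ofReal (Real.exp (a n u))) atTop
      (𝓝 (ENNReal.ofReal (Real.exp (a₀ u)))) := fun u hu =>
    ENNReal.tendsto_ofReal ((Real.continuous_exp.tendsto _).comp (ha u hu))
  have htr : ∀ k : ℕ, Tendsto (fun n => ∫⁻ x, (truncExp u k x : ℝ≥0∞) ∂(ν n : Measure ℝ)) atTop
      (𝓝 (∫⁻ x, (truncExp u k x : ℝ≥0∞) ∂(ν₀ : Measure ℝ))) := fun k =>
    ProbabilityMeasure.tendsto_iff_forall_lintegral_tendsto.1 hν (truncExp u k)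
  apply le_antisymm
  · rw [lintegral_exp_eq_iSup]
    refine iSup_le fun k => le_of_tendsto_of_tendsto' (htr k) (hlim u hu) fun n => ?_
    rw [← hexp n u hu]
    refine lintegral_mono fun x => ?_
    rw [coe_truncExp]
    exact min_le_left _ _
  · have key : ∀ k : ℕ, 0 < k → ENNReal.ofReal (Real.exp (a₀ u)) ≤
        ∫⁻ x, ENNReal.ofReal (Real.exp (u * x)) ∂(ν₀ : Measure ℝ) +
          ENNReal.ofReal (1 / k) * ENNReal.ofReal (Real.exp (a₀ (2 * u))) := by
      intro k hk
      have h1 : ENNReal.ofReal (Real.exp (a₀ u)) ≤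
          ∫⁻ x, (truncExp u k x : ℝ≥0∞) ∂(ν₀ : Measure ℝ) +
          ENNReal.ofReal (1 / k) * ENNReal.ofReal (Real.exp (a₀ (2 * u))) := by
        refine le_of_tendsto_of_tendsto' (hlim u hu) ((htr k).add
          (ENNReal.Tendsto.const_mul (hlim (2 * u) (by positivity))
            (Or.inr ENNReal.ofReal_ne_top))) fun n => ?_
        rw [← hexp n u hu, ← hexp n (2 * u) (by positivity),
          ← lintegral_const_mul _ (by fun_prop), ← lintegral_add_right _ (by fun_prop)]
        exact lintegral_mono fun x => ofReal_exp_le_truncExp_add u x hk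
      refine h1.trans (add_le_add_left ?_ _)
      rw [lintegral_exp_eq_iSup]
      exact le_iSup (fun k : ℕ => ∫⁻ x, (truncExp u k x : ℝ≥0∞) ∂(ν₀ : Measure ℝ)) k
    have h0 : Tendsto (fun k : ℕ => ∫⁻ x, ENNReal.ofReal (Real.exp (u * x)) ∂(ν₀ : Measure ℝ) +
        ENNReal.ofReal (1 / k) * ENNReal.ofReal (Real.exp (a₀ (2 * u)))) atTop
        (𝓝 (∫⁻ x, ENNReal.ofReal (Real.exp (u * x)) ∂(ν₀ : Measure ℝ) +
          0 * ENNReal.ofReal (Real.exp (a₀ (2 * u))))) := by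
      refine tendsto_const_nhds.add (ENNReal.Tendsto.mul_const ?_ (Or.inr ENNReal.ofReal_ne_top))
      simpa using ENNReal.tendsto_ofReal tendsto_one_div_atTop_nhds_zero_nat
    rw [zero_mul, add_zero] at h0
    exact ge_of_tendsto h0 (eventually_atTop.2 ⟨1, fun k hk => key k hk⟩)

lemma jumpExponent_smul (t : ℝ≥0) (d : ℝ) (g : Measure ℝ) (z : ℂ) :
    jumpExponent (t * d) (t • g) z = (t : ℝ) * jumpExponent d g z := by
  simp only [jumpExponent, integral_smul_nnreal_measure, NNReal.smul_def, Complex.real_smul]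
  push_cast
  ring

lemma realJumpExponent_smul (t : ℝ≥0) (d : ℝ) (g : Measure ℝ) (u : ℝ) :
    realJumpExponent (t * d) (t • g) u = t * realJumpExponent d g u := by
  simp only [realJumpExponent, integral_smul_nnreal_measure, NNReal.smul_def, smul_eq_mul]
  ring

/-- A measure with the Lévy–Khintchine characteristic function of a spectrally negative triplet is
a weak limit of compound Poisson laws with drift, hence has the expected exponential moments. -/
lemma lintegral_exp_of_charFun {L : Measure ℝ} (hL : IsLevyMeasure L)
    (hpos : L (Set.Ioi 0) = 0) (μ σ : ℝ) (t : ℝ≥0) (ν : Measure ℝ) [hν : IsProbabilityMeasure ν]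
    (hchar : ∀ θ : ℝ, charFun ν θ
      = Complex.exp (-((t : ℝ) : ℂ) * levyKhintchineExponent μ σ L θ)) {u : ℝ} (hu : 0 ≤ u) :
    ∫⁻ x, ENNReal.ofReal (Real.exp (u * x)) ∂ν
      = ENNReal.ofReal (Real.exp (t * (complexExponent μ σ L u).re)) := by
  have hfin := isFiniteMeasure_approxMeasure hL σ
  let d : ℕ → ℝ := approxDrift μ σ L
  let g : ℕ → Measure ℝ := approxMeasure σ L
  let ν' : ℕ → ProbabilityMeasure ℝ := fun n =>
    ⟨driftCompoundPoisson (t * d n) (t • g n), inferInstance⟩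
  let ν₀ : ProbabilityMeasure ℝ := ⟨ν, hν⟩
  have hlim : Tendsto ν' atTop (𝓝 ν₀) := by
    refine ProbabilityMeasure.tendsto_of_tendsto_charFun fun θ => ?_
    simp only [ν', ν₀, ProbabilityMeasure.coe_mk, charFun_driftCompoundPoisson, hchar,
      jumpExponent_smul]
    refine (Complex.continuous_exp.tendsto _).comp ?_
    rw [neg_mul, ← mul_neg, ← complexExponent_I_mul]
    exact (tendsto_jumpExponent_approx hL hpos μ σ (by simp)).const_mul _
  refine lintegral_exp_of_tendsto (ν₀ := ν₀) (a := fun n u => t * realJumpExponent (d n) (g n) u)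
    (a₀ := fun u => t * (complexExponent μ σ L u).re) hlim ?_ ?_ hu
  · intro u hu
    exact (tendsto_realJumpExponent_approx hL hpos μ σ hu).const_mul _
  · intro n u hu
    have h0 : (t • g n) (Set.Ici 0) = 0 := by
      rw [Measure.smul_apply, approxMeasure_Ici_zero, smul_zero]
    rw [← realJumpExponent_smul]
    exact lintegral_exp_driftCompoundPoisson _ _ _ (integrable_exp_of_Ici_zero h0 hu)

/-! ### Scale measures of compound Poisson processes with drift -/

lemma lintegral_exp_neg_Ioc {β : ℝ} (hβ : 0 < β) {a : ℝ} (ha : 0 ≤ a) :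
    ∫⁻ x in Set.Ioc 0 a, ENNReal.ofReal (Real.exp (-β * x))
      = ENNReal.ofReal ((1 - Real.exp (-β * a)) / β) := by
  rw [← ofReal_integral_eq_lintegral_ofReal, ← intervalIntegral.integral_of_le ha]
  · congr 1
    rw [intervalIntegral.integral_comp_mul_left (fun x => Real.exp x) (by linarith), integral_exp]
    simp only [mul_zero, Real.exp_zero, smul_eq_mul]
    field_simp
    ring
  · exact (Continuous.integrableOn_Icc (by fun_prop)).mono_set Set.Ioc_subset_Icc_self
  · exact ae_of_all _ fun x => (Real.exp_pos _).le

lemma lintegral_exp_neg_Ioi {β : ℝ} (hβ : 0 < β) (a : ℝ) :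
    ∫⁻ x in Set.Ioi a, ENNReal.ofReal (Real.exp (-β * x))
      = ENNReal.ofReal (Real.exp (-β * a) / β) := by
  rw [← ofReal_integral_eq_lintegral_ofReal (integrableOn_exp_mul_Ioi (by linarith) a)
    (ae_of_all _ fun x => (Real.exp_pos _).le), integral_exp_mul_Ioi (by linarith)]
  congr 1
  rw [neg_div_neg_eq]

/-- The measure `(q + g(-∞, -x]) dx` on `(0, ∞)`, the second summand written as the law of the
second coordinate of `g ⊗ dx` restricted to `0 < x ≤ -y`. -/
noncomputable def tailMeasure (q : ℝ) (g : Measure ℝ) : Measure ℝ :=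
  ENNReal.ofReal q • volume.restrict (Set.Ioi 0) +
    ((g.prod volume).restrict {p : ℝ × ℝ | 0 < p.2 ∧ p.2 ≤ -p.1}).map Prod.snd

instance sfinite_tailMeasure (q : ℝ) (g : Measure ℝ) [SFinite g] : SFinite (tailMeasure q g) := by
  unfold tailMeasure; infer_instance

lemma measurableSet_tail : MeasurableSet {p : ℝ × ℝ | 0 < p.2 ∧ p.2 ≤ -p.1} :=
  (measurableSet_lt measurable_const measurable_snd).inter
    (measurableSet_le measurable_snd measurable_fst.neg)

lemma tailMeasure_Iio_zero (q : ℝ) (g : Measure ℝ) : tailMeasure q g (Set.Iio 0) = 0 := by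
  have h1 : Set.Iio (0 : ℝ) ∩ Set.Ioi 0 = ∅ := by
    ext x; simp only [Set.mem_inter_iff, Set.mem_Iio, Set.mem_Ioi, Set.mem_empty_iff_false,
      iff_false]; intro h; linarith [h.1, h.2]
  have h2 : Prod.snd ⁻¹' Set.Iio (0 : ℝ) ∩ {p : ℝ × ℝ | 0 < p.2 ∧ p.2 ≤ -p.1} = ∅ := by
    ext p; simp only [Set.mem_inter_iff, Set.mem_preimage, Set.mem_Iio, Set.mem_ofPred_eq,
      Set.mem_empty_iff_false, iff_false]; intro h; linarith [h.1, h.2.1]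
  rw [tailMeasure, Measure.add_apply, Measure.smul_apply,
    Measure.restrict_apply measurableSet_Iio, h1,
    Measure.map_apply measurable_snd measurableSet_Iio,
    Measure.restrict_apply (measurable_snd measurableSet_Iio), h2]
  simp

/-- Integration by parts: the Laplace transform of the tail of `g` is `∫ (1 - e^{βx}) g(dx) / β`. -/
lemma lintegral_exp_tailMeasure {q : ℝ} (hq : 0 ≤ q) (g : Measure ℝ) [IsFiniteMeasure g]
    (hg : g (Set.Ici 0) = 0) (d : ℝ) {β : ℝ} (hβ : 0 < β) :
    ∫⁻ x, ENNReal.ofReal (Real.exp (-β * x)) ∂(tailMeasure q g)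
      = ENNReal.ofReal (d - (realJumpExponent d g β - q) / β) := by
  have hneg : ∀ᵐ y ∂g, y < 0 := ae_neg_of_Ici_zero hg
  have hint := integrable_exp_of_Ici_zero hg hβ.le
  have h1 : ∫⁻ y, (∫⁻ x, ({p : ℝ × ℝ | 0 < p.2 ∧ p.2 ≤ -p.1}).indicator
      (fun p => ENNReal.ofReal (Real.exp (-β * p.2))) (y, x)) ∂g =
      ∫⁻ y, ENNReal.ofReal ((1 - Real.exp (β * y)) / β) ∂g := by
    refine lintegral_congr_ae ?_
    filter_upwards [hneg] with y hy
    have : ∀ x : ℝ, ({p : ℝ × ℝ | 0 < p.2 ∧ p.2 ≤ -p.1}).indicator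
        (fun p => ENNReal.ofReal (Real.exp (-β * p.2))) (y, x)
        = (Set.Ioc 0 (-y)).indicator (fun x => ENNReal.ofReal (Real.exp (-β * x))) x :=
      fun x => rfl
    simp_rw [this]
    rw [lintegral_indicator measurableSet_Ioc, lintegral_exp_neg_Ioc hβ (by linarith)]
    congr 4
    ring
  have hnn : 0 ≤ᵐ[g] fun y => (1 - Real.exp (β * y)) / β := by
    filter_upwards [hneg] with y hy
    have : Real.exp (β * y) ≤ 1 :=
      Real.exp_le_one_iff.2 (mul_nonpos_of_nonneg_of_nonpos hβ.le hy.le)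
    exact div_nonneg (by linarith) hβ.le
  have hint2 : Integrable (fun y => (1 - Real.exp (β * y)) / β) g :=
    ((integrable_const _).sub hint).div_const β
  rw [tailMeasure, lintegral_add_measure, lintegral_smul_measure,
    lintegral_exp_neg_Ioi hβ, lintegral_map (by fun_prop) measurable_snd,
    ← lintegral_indicator measurableSet_tail,
    lintegral_prod _ ((Measurable.indicator (by fun_prop) measurableSet_tail).aemeasurable), h1,
    ← ofReal_integral_eq_lintegral_ofReal hint2 hnn, smul_eq_mul, ← ENNReal.ofReal_mul hq,
    ← ENNReal.ofReal_add (by positivity) (integral_nonneg_of_ae hnn), integral_div]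
  congr 1
  have h2 : ∫ y, (1 - Real.exp (β * y)) ∂g = -∫ y, (Real.exp (β * y) - 1) ∂g := by
    rw [← integral_neg]; congr 1; ext y; ring
  rw [h2, realJumpExponent]
  simp only [mul_zero, Real.exp_zero]
  field_simp
  ring

/-- If `κ(b) > q` for the exponent `κ` of a compound Poisson process with drift `d`, then
`β / (κ(β) - q)` is the Laplace transform of a measure for `β ≥ b`: with `h` the tail measure, it
is the sum of the geometric series `∑ₖ ĥ(β)^k / d^{k+1}`. -/
lemma exists_scaleMeasure_of_jumpExponent {q : ℝ} (hq : 0 ≤ q) (g : Measure ℝ) [IsFiniteMeasure g]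
    (hg : g (Set.Ici 0) = 0) (d : ℝ) {b : ℝ} (hb : 0 < b) (hbq : q < realJumpExponent d g b) :
    ∃ U : Measure ℝ, U (Set.Iio 0) = 0 ∧ ∀ β, b ≤ β →
      ∫⁻ x, ENNReal.ofReal (Real.exp (-β * x)) ∂U
        = ENNReal.ofReal (β / (realJumpExponent d g β - q)) := by
  have hI : ∀ β, 0 < β → ∫ x, (Real.exp (β * x) - 1) ∂g ≤ 0 := by
    intro β hβ
    refine integral_nonpos_of_ae ?_
    have hneg : ∀ᵐ y ∂g, y < 0 := ae_neg_of_Ici_zero hg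
    filter_upwards [hneg] with y hy
    have : Real.exp (β * y) ≤ 1 :=
      Real.exp_le_one_iff.2 (mul_nonpos_of_nonneg_of_nonpos hβ.le hy.le)
    simpa using this
  have hd : 0 < d := by
    have h1 := hI b hb
    rw [realJumpExponent] at hbq
    have : 0 < d * b := by linarith
    exact pos_of_mul_pos_left this hb.le
  refine ⟨convSeries (fun k => ENNReal.ofReal (d⁻¹ ^ (k + 1))) (tailMeasure q g),
    convSeries_Iio_zero _ _ (tailMeasure_Iio_zero q g), fun β hβ => ?_⟩
  have hβ0 : 0 < β := hb.trans_le hβ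
  -- the ratio of the geometric series decreases in `β`, and is less than `1` at `b`
  have hlt : ∫⁻ x, ENNReal.ofReal (Real.exp (-β * x)) ∂(tailMeasure q g) < ENNReal.ofReal d := by
    have hpos : ∀ᵐ x ∂(tailMeasure q g), 0 ≤ x := ae_nonneg_of_Iio_zero (tailMeasure_Iio_zero q g)
    calc ∫⁻ x, ENNReal.ofReal (Real.exp (-β * x)) ∂(tailMeasure q g)
        ≤ ∫⁻ x, ENNReal.ofReal (Real.exp (-b * x)) ∂(tailMeasure q g) := by
          refine lintegral_mono_ae ?_
          filter_upwards [hpos] with x hx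
          refine ENNReal.ofReal_le_ofReal (Real.exp_le_exp.2 ?_)
          nlinarith
      _ < ENNReal.ofReal d := by
          rw [lintegral_exp_tailMeasure hq g hg d hb]
          refine (ENNReal.ofReal_lt_ofReal_iff hd).2 ?_
          have : 0 < (realJumpExponent d g b - q) / b := div_pos (by linarith) hb
          linarith
  rw [lintegral_exp_convSeries]
  set r : ℝ≥0∞ := ∫⁻ x, ENNReal.ofReal (Real.exp (-β * x)) ∂(tailMeasure q g) with hr
  have hr' := lintegral_exp_tailMeasure hq g hg d hβ0
  rw [← hr] at hr'
  set κ := (realJumpExponent d g β - q) / β with hκ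
  have hκ0 : 0 < κ := by
    rw [hr', ENNReal.ofReal_lt_ofReal_iff hd] at hlt
    linarith
  have hterm : ∀ k : ℕ, ENNReal.ofReal (d⁻¹ ^ (k + 1)) * r ^ k
      = ENNReal.ofReal d⁻¹ * (ENNReal.ofReal d⁻¹ * r) ^ k := by
    intro k
    rw [pow_succ, ENNReal.ofReal_mul (by positivity), ENNReal.ofReal_pow (by positivity), mul_pow]
    ring
  simp_rw [hterm]
  rw [ENNReal.tsum_mul_left, ENNReal.tsum_geometric]
  have hdκ : 0 ≤ d - κ := by
    have h1 := hI β hβ0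
    have h2 : d - κ = (q - ∫ x, (Real.exp (β * x) - 1) ∂g) / β := by
      rw [hκ, realJumpExponent]
      field_simp
      ring
    rw [h2]
    exact div_nonneg (by linarith) hβ0.le
  have h1 : 1 - ENNReal.ofReal d⁻¹ * r = ENNReal.ofReal (d⁻¹ * κ) := by
    rw [hr', ← ENNReal.ofReal_mul (by positivity), ← ENNReal.ofReal_one,
      ← ENNReal.ofReal_sub _ (by positivity)]
    congr 1
    field_simp
    ring
  rw [h1, ← ENNReal.ofReal_inv_of_pos (by positivity), ← ENNReal.ofReal_mul (by positivity)]
  congr 1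
  have hnum : 0 < realJumpExponent d g β - q := by
    have := mul_pos hκ0 hβ0
    rwa [hκ, div_mul_cancel₀ _ hβ0.ne'] at this
  rw [hκ]
  field_simp

/-! ### Laplace transforms of measures on the half-line -/

/-- The compactification `x ↦ e^{-x}` of the half-line `[0, ∞)` into `[0, 1]`, which turns Laplace
transforms into moments; negative `x` are sent to `1`. -/
noncomputable def expNeg (x : ℝ) : Set.Icc (0 : ℝ) 1 :=
  Set.projIcc 0 1 zero_le_one (Real.exp (-x))

lemma coe_expNeg {x : ℝ} (hx : 0 ≤ x) : (expNeg x : ℝ) = Real.exp (-x) := by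
  rw [expNeg, Set.projIcc_of_mem zero_le_one
    ⟨(Real.exp_pos _).le, Real.exp_le_one_iff.2 (by linarith)⟩]

lemma measurable_expNeg : Measurable expNeg :=
  (continuous_projIcc.comp (by fun_prop)).measurable

/-- Uniqueness of Laplace transforms: a finite measure on `[0, ∞)` is determined by the values of
its Laplace transform at the integers, by Weierstrass' theorem on `[0, 1]`. -/
lemma ext_of_laplace {ν₁ ν₂ : Measure ℝ} [IsFiniteMeasure ν₁] [IsFiniteMeasure ν₂]
    (h₁ : ν₁ (Set.Iio 0) = 0) (h₂ : ν₂ (Set.Iio 0) = 0)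
    (h : ∀ n : ℕ, ∫ x, Real.exp (-n * x) ∂ν₁ = ∫ x, Real.exp (-n * x) ∂ν₂) : ν₁ = ν₂ := by
  have hback : ∀ ν : Measure ℝ, ν (Set.Iio 0) = 0 →
      (ν.map expNeg).map (fun y : Set.Icc (0 : ℝ) 1 => -Real.log y) = ν := by
    intro ν hν
    rw [Measure.map_map (by fun_prop) measurable_expNeg]
    conv_rhs => rw [← Measure.map_id (μ := ν)]
    refine Measure.map_congr ?_
    filter_upwards [ae_nonneg_of_Iio_zero hν] with x hx
    simp [coe_expNeg hx]
  have hmom : ∀ ν : Measure ℝ, ν (Set.Iio 0) = 0 → ∀ n : ℕ,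
      ∫ y : Set.Icc (0 : ℝ) 1, (y : ℝ) ^ n ∂(ν.map expNeg) = ∫ x, Real.exp (-n * x) ∂ν := by
    intro ν hν n
    rw [integral_map measurable_expNeg.aemeasurable
      (Continuous.aestronglyMeasurable (by fun_prop))]
    refine integral_congr_ae ?_
    filter_upwards [ae_nonneg_of_Iio_zero hν] with x hx
    rw [coe_expNeg hx, ← Real.exp_nat_mul]
    congr 1; ring
  have hfin₁ : IsFiniteMeasure (ν₁.map expNeg) := inferInstance
  have hfin₂ : IsFiniteMeasure (ν₂.map expNeg) := inferInstance
  have hint : ∀ (M : Measure (Set.Icc (0 : ℝ) 1)) [IsFiniteMeasure M] (f : C(Set.Icc (0 : ℝ) 1, ℝ)),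
      Integrable f M := fun M _ f => f.continuous.integrable_of_hasCompactSupport
        (HasCompactSupport.of_compactSpace _)
  have hcont : ∀ (M : Measure (Set.Icc (0 : ℝ) 1)) [IsFiniteMeasure M],
      Continuous fun f : C(Set.Icc (0 : ℝ) 1, ℝ) => ∫ y, f y ∂M := by
    intro M _
    have := (continuous_integral (μ := M) (G := ℝ)).comp
      (ContinuousMap.toLp (E := ℝ) 1 M ℝ).continuous
    refine this.congr fun f => ?_
    exact integral_congr_ae (ContinuousMap.coeFn_toLp M f)
  have hpoly : ∀ p : Polynomial ℝ, ∫ y : Set.Icc (0 : ℝ) 1, p.eval (y : ℝ) ∂(ν₁.map expNeg)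
      = ∫ y : Set.Icc (0 : ℝ) 1, p.eval (y : ℝ) ∂(ν₂.map expNeg) := by
    intro p
    simp_rw [Polynomial.eval_eq_sum_range]
    rw [integral_finsetSum, integral_finsetSum]
    · refine Finset.sum_congr rfl fun n _ => ?_
      rw [integral_const_mul, integral_const_mul, hmom ν₁ h₁, hmom ν₂ h₂, h n]
    · exact fun n _ => hint _ ⟨fun y : Set.Icc (0 : ℝ) 1 => p.coeff n * (y : ℝ) ^ n, by fun_prop⟩
    · exact fun n _ => hint _ ⟨fun y : Set.Icc (0 : ℝ) 1 => p.coeff n * (y : ℝ) ^ n, by fun_prop⟩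
  have heq : ν₁.map expNeg = ν₂.map expNeg := by
    refine ext_of_forall_integral_eq_of_IsFiniteMeasure fun f => ?_
    have hclosed : IsClosed {f : C(Set.Icc (0 : ℝ) 1, ℝ) |
        ∫ y, f y ∂(ν₁.map expNeg) = ∫ y, f y ∂(ν₂.map expNeg)} :=
      isClosed_eq (hcont _) (hcont _)
    have hsub : ((polynomialFunctions (Set.Icc (0 : ℝ) 1) : Subalgebra ℝ _) : Set _) ⊆
        {f : C(Set.Icc (0 : ℝ) 1, ℝ) |
          ∫ y, f y ∂(ν₁.map expNeg) = ∫ y, f y ∂(ν₂.map expNeg)} := by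
      rintro _ ⟨p, -, rfl⟩
      exact hpoly p
    have hmem := continuousMap_mem_polynomialFunctions_closure 0 1 f.toContinuousMap
    rw [← SetLike.mem_coe, Subalgebra.topologicalClosure_coe] at hmem
    exact hclosed.closure_subset_iff.2 hsub hmem
  rw [← hback ν₁ h₁, ← hback ν₂ h₂, heq]

/-- The power `y ↦ y^s` as a bounded continuous function on `[0, 1]`. -/
noncomputable def powBCF {s : ℝ} (hs : 0 ≤ s) :
    BoundedContinuousFunction (Set.Icc (0 : ℝ) 1) ℝ≥0 :=
  BoundedContinuousFunction.mkOfCompact ⟨fun y => Real.toNNReal ((y : ℝ) ^ s),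
    continuous_real_toNNReal.comp
      ((Real.continuous_rpow_const hs).comp continuous_subtype_val)⟩

lemma coe_powBCF {s : ℝ} (hs : 0 ≤ s) (y : Set.Icc (0 : ℝ) 1) :
    ((powBCF hs y : ℝ≥0) : ℝ≥0∞) = ENNReal.ofReal ((y : ℝ) ^ s) := rfl

/-- Continuity theorem for Laplace transforms on `[b, ∞)`. The tilted measures `e^{-bx} Uₙ(dx)`
are transported to the compact space `[0, 1]` by `x ↦ e^{-x}`, where they have a limit point; right
continuity of the limit transform at `b` prevents mass from escaping to `x = ∞`. -/
lemma exists_measure_of_tendsto_laplace {U : ℕ → Measure ℝ} (hU : ∀ n, U n (Set.Iio 0) = 0)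
    {F : ℕ → ℝ → ℝ} {F₀ : ℝ → ℝ} {b : ℝ}
    (hF : ∀ n β, b ≤ β → ∫⁻ x, ENNReal.ofReal (Real.exp (-β * x)) ∂(U n)
      = ENNReal.ofReal (F n β))
    (hlim : ∀ β, b ≤ β → Tendsto (fun n => F n β) atTop (𝓝 (F₀ β)))
    (hcont : ContinuousWithinAt F₀ (Set.Ici b) b) :
    ∃ V : Measure ℝ, SFinite V ∧ V (Set.Iio 0) = 0 ∧ ∀ β, b ≤ β →
      ∫⁻ x, ENNReal.ofReal (Real.exp (-β * x)) ∂V = ENNReal.ofReal (F₀ β) := by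
  have htilt : ∀ n, IsFiniteMeasure
      ((U n).withDensity fun x => ENNReal.ofReal (Real.exp (-b * x))) := fun n =>
    isFiniteMeasure_withDensity (by rw [hF n b le_rfl]; exact ENNReal.ofReal_ne_top)
  let M : ℕ → FiniteMeasure (Set.Icc (0 : ℝ) 1) := fun n =>
    ⟨((U n).withDensity fun x => ENNReal.ofReal (Real.exp (-b * x))).map expNeg, inferInstance⟩
  have hM : ∀ n s (hs : 0 ≤ s), ∫⁻ y, (powBCF hs y : ℝ≥0∞) ∂(M n : Measure (Set.Icc (0 : ℝ) 1))
      = ENNReal.ofReal (F n (b + s)) := by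
    intro n s hs
    rw [← hF n (b + s) (by linarith)]
    change ∫⁻ y, (powBCF hs y : ℝ≥0∞)
      ∂(((U n).withDensity fun x => ENNReal.ofReal (Real.exp (-b * x))).map expNeg) = _
    have hmeas : Measurable fun y => (powBCF hs y : ℝ≥0∞) :=
      (powBCF hs).continuous.measurable.coe_nnreal_ennreal
    rw [lintegral_map hmeas measurable_expNeg,
      lintegral_withDensity_eq_lintegral_mul (U n)
        (f := fun x => ENNReal.ofReal (Real.exp (-b * x))) (by fun_prop)
        (g := fun x => (powBCF hs (expNeg x) : ℝ≥0∞)) (hmeas.comp measurable_expNeg)]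
    refine lintegral_congr_ae ?_
    have hae : ∀ᵐ x ∂(U n), 0 ≤ x := ae_nonneg_of_Iio_zero (hU n)
    filter_upwards [hae] with x hx
    rw [Pi.mul_apply, coe_powBCF, coe_expNeg hx, ← Real.exp_mul,
      ← ENNReal.ofReal_mul (Real.exp_pos _).le, ← Real.exp_add]
    congr 2
    ring
  have hmass : ∀ n, ((M n).mass : ℝ≥0∞) = ENNReal.ofReal (F n b) := by
    intro n
    have h := hM n 0 le_rfl
    simp only [coe_powBCF, Real.rpow_zero, ENNReal.ofReal_one, lintegral_one, add_zero] at h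
    rw [← h, FiniteMeasure.ennreal_mass]
  let G : Ultrafilter ℕ := Ultrafilter.of atTop
  have hG : (G : Filter ℕ) ≤ atTop := Ultrafilter.of_le _
  have hC : ∀ᶠ n in (G : Filter ℕ), (M n).mass ≤ Real.toNNReal (F₀ b + 1) := by
    refine hG (((hlim b le_rfl).eventually_lt_const (lt_add_one _)).mono fun n hn => ?_)
    rw [← ENNReal.coe_le_coe, hmass]
    exact ENNReal.ofReal_le_ofReal hn.le
  obtain ⟨M₀, -, hM₀⟩ := (isCompact_setOfPred_finiteMeasure_le_of_compactSpace
    (Set.Icc (0 : ℝ) 1) (Real.toNNReal (F₀ b + 1))).ultrafilter_le_nhds (G.map M)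
    (le_principal_iff.2 hC)
  have hM₀' : Tendsto M G (𝓝 M₀) := hM₀
  have hmom : ∀ s (hs : 0 ≤ s),
      ∫⁻ y, ENNReal.ofReal ((y : ℝ) ^ s) ∂(M₀ : Measure (Set.Icc (0 : ℝ) 1))
        = ENNReal.ofReal (F₀ (b + s)) := by
    intro s hs
    have h1 := FiniteMeasure.tendsto_iff_forall_lintegral_tendsto.1 hM₀' (powBCF hs)
    simp_rw [hM] at h1
    exact tendsto_nhds_unique h1
      ((ENNReal.tendsto_ofReal (hlim (b + s) (by linarith))).mono_left hG)
  -- `y = 0` stands for `x = ∞`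
  have hzero : (M₀ : Measure (Set.Icc (0 : ℝ) 1)) {y | (y : ℝ) = 0} = 0 := by
    have hms : MeasurableSet {y : Set.Icc (0 : ℝ) 1 | (y : ℝ) = 0} :=
      measurableSet_eq_fun (by fun_prop) (by fun_prop)
    have hle : ∀ s, 0 < s → ENNReal.ofReal (F₀ (b + s))
        ≤ (M₀ : Measure (Set.Icc (0 : ℝ) 1)) {y | (y : ℝ) = 0}ᶜ := by
      intro s hs
      rw [← hmom s hs.le, ← lintegral_indicator_one hms.compl]
      refine lintegral_mono fun y => ?_
      by_cases hy : (y : ℝ) = 0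
      · simp [hy, Real.zero_rpow hs.ne']
      · rw [Set.indicator_of_mem (by simpa using hy)]
        simpa using Real.rpow_le_one y.2.1 y.2.2 hs.le
    have hle0 : ENNReal.ofReal (F₀ b)
        ≤ (M₀ : Measure (Set.Icc (0 : ℝ) 1)) {y | (y : ℝ) = 0}ᶜ := by
      have ht : Tendsto (fun n : ℕ => F₀ (b + 1 / ((n : ℝ) + 1))) atTop (𝓝 (F₀ b)) := by
        refine Tendsto.comp hcont (tendsto_nhdsWithin_iff.2 ⟨?_, Eventually.of_forall fun n => ?_⟩)
        · simpa using tendsto_one_div_add_atTop_nhds_zero_nat.const_add b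
        · have : (0 : ℝ) < 1 / ((n : ℝ) + 1) := by positivity
          simp only [Set.mem_Ici]; linarith
      exact le_of_tendsto' (ENNReal.tendsto_ofReal ht) fun n => hle _ (by positivity)
    have htot : ENNReal.ofReal (F₀ b) = (M₀ : Measure (Set.Icc (0 : ℝ) 1)) Set.univ := by
      have h := hmom 0 le_rfl
      simpa using h.symm
    have hadd := measure_add_measure_compl (μ := (M₀ : Measure (Set.Icc (0 : ℝ) 1))) hms
    rw [← htot] at hadd
    have hfin : (M₀ : Measure (Set.Icc (0 : ℝ) 1)) {y | (y : ℝ) = 0}ᶜ ≠ ⊤ := measure_ne_top _ _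
    refine le_antisymm ?_ zero_le
    refine (ENNReal.add_le_add_iff_right hfin).1 ?_
    rw [hadd, zero_add]
    exact hle0
  let log' : Set.Icc (0 : ℝ) 1 → ℝ := fun y => -Real.log y
  have hlog : Measurable log' := by fun_prop
  refine ⟨((M₀ : Measure (Set.Icc (0 : ℝ) 1)).map log').withDensity
    fun x => ENNReal.ofReal (Real.exp (b * x)), inferInstance, ?_, ?_⟩
  · refine withDensity_absolutelyContinuous _ _ ?_
    rw [Measure.map_apply hlog measurableSet_Iio]
    have hempty : log' ⁻¹' Set.Iio 0 = ∅ := by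
      ext y
      have : Real.log y ≤ 0 := Real.log_nonpos y.2.1 y.2.2
      simpa [log'] using this
    rw [hempty, measure_empty]
  · intro β hβ
    rw [lintegral_withDensity_eq_lintegral_mul _ (by fun_prop) (by fun_prop),
      lintegral_map (by fun_prop) hlog]
    have h := hmom (β - b) (by linarith)
    rw [add_sub_cancel] at h
    rw [← h]
    refine lintegral_congr_ae ?_
    have hae : ∀ᵐ y : Set.Icc (0 : ℝ) 1 ∂(M₀ : Measure (Set.Icc (0 : ℝ) 1)), (y : ℝ) ≠ 0 := by
      rw [ae_iff]; simpa using hzero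
    filter_upwards [hae] with y hy
    have hy0 : 0 < (y : ℝ) := lt_of_le_of_ne y.2.1 (Ne.symm hy)
    rw [Pi.mul_apply, ← ENNReal.ofReal_mul (Real.exp_pos _).le, ← Real.exp_add,
      Real.rpow_def_of_pos hy0]
    congr 2
    simp only [log']
    ring

/-! ### Distribution functions and their Laplace transforms -/

lemma measure_Iic_lt_top_of_laplace {V : Measure ℝ} {b : ℝ} (hb : 0 < b)
    (hfin : ∫⁻ x, ENNReal.ofReal (Real.exp (-b * x)) ∂V < ⊤) (x : ℝ) : V (Set.Iic x) < ⊤ := by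
  have h1 : ENNReal.ofReal (Real.exp (-b * x)) * V (Set.Iic x)
      ≤ ∫⁻ x, ENNReal.ofReal (Real.exp (-b * x)) ∂V := by
    refine le_trans ?_ (mul_meas_ge_le_lintegral (by fun_prop)
      (ENNReal.ofReal (Real.exp (-b * x))))
    gcongr
    intro y hy
    have hy' : y ≤ x := hy
    exact ENNReal.ofReal_le_ofReal (Real.exp_le_exp.2 (by nlinarith))
  exact (ENNReal.mul_lt_top_iff.1 (h1.trans_lt hfin)).elim (fun h => h.2) fun h =>
    h.elim (fun h => absurd h (by simp [Real.exp_pos])) fun h => by simp [h]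

lemma continuousWithinAt_measure_Iic {V : Measure ℝ} (hV : ∀ x, V (Set.Iic x) < ⊤) (x : ℝ) :
    ContinuousWithinAt (fun x => (V (Set.Iic x)).toReal) (Set.Ici x) x := by
  rw [← continuousWithinAt_Ioi_iff_Ici]
  have h := tendsto_measure_biInter_gt (μ := V) (s := fun r : ℝ => Set.Iic r) (a := x)
    (fun r _ => measurableSet_Iic.nullMeasurableSet)
    (fun i j _ hij => Set.Iic_subset_Iic.2 hij) ⟨x + 1, by simp, (hV _).ne⟩
  have hI : ⋂ r > x, Set.Iic r = Set.Iic x := by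
    ext y
    simp only [Set.mem_iInter, Set.mem_Iic]
    exact ⟨fun h => le_of_forall_gt_imp_ge_of_dense h, fun h r hr => h.trans (le_of_lt hr)⟩
  rw [hI] at h
  exact (ENNReal.tendsto_toReal (hV x).ne).comp h

/-- The Laplace transform of the distribution function of `V` is that of `V`, divided by `β`. -/
lemma lintegral_exp_mul_measure_Iic {V : Measure ℝ} [SFinite V] (hV : V (Set.Iio 0) = 0) {β : ℝ}
    (hβ : 0 < β) :
    ∫⁻ x in Set.Ioi 0, ENNReal.ofReal (Real.exp (-β * x)) * V (Set.Iic x)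
      = ENNReal.ofReal β⁻¹ * ∫⁻ x, ENNReal.ofReal (Real.exp (-β * x)) ∂V := by
  have hms : MeasurableSet {p : ℝ × ℝ | p.2 ≤ p.1} :=
    measurableSet_le measurable_snd measurable_fst
  have h1 : ∀ x : ℝ, ENNReal.ofReal (Real.exp (-β * x)) * V (Set.Iic x) =
      ∫⁻ y, ({p : ℝ × ℝ | p.2 ≤ p.1}).indicator
        (fun p => ENNReal.ofReal (Real.exp (-β * p.1))) (x, y) ∂V := by
    intro x
    have : ∀ y, ({p : ℝ × ℝ | p.2 ≤ p.1}).indicator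
        (fun p => ENNReal.ofReal (Real.exp (-β * p.1))) (x, y)
        = (Set.Iic x).indicator (fun _ => ENNReal.ofReal (Real.exp (-β * x))) y := fun y => rfl
    simp_rw [this]
    rw [lintegral_indicator_const measurableSet_Iic]
  simp_rw [h1]
  have hmeas : Measurable (Function.uncurry fun x y : ℝ => ({p : ℝ × ℝ | p.2 ≤ p.1}).indicator
      (fun p => ENNReal.ofReal (Real.exp (-β * p.1))) (x, y)) :=
    Measurable.indicator (f := fun p : ℝ × ℝ => ENNReal.ofReal (Real.exp (-β * p.1)))
      (by fun_prop) hms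
  rw [lintegral_lintegral_swap hmeas.aemeasurable, ← lintegral_const_mul _ (by fun_prop)]
  refine lintegral_congr_ae ?_
  have hae : ∀ᵐ y ∂V, 0 ≤ y := ae_nonneg_of_Iio_zero hV
  filter_upwards [hae] with y hy
  have h2 : ∀ x, ({p : ℝ × ℝ | p.2 ≤ p.1}).indicator
      (fun p => ENNReal.ofReal (Real.exp (-β * p.1))) (x, y)
      = (Set.Ici y).indicator (fun x => ENNReal.ofReal (Real.exp (-β * x))) x := fun x => rfl
  simp_rw [h2]
  rw [lintegral_indicator measurableSet_Ici, Measure.restrict_restrict measurableSet_Ici,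
    setLIntegral_congr (t := Set.Ioi y), lintegral_exp_neg_Ioi hβ,
    ← ENNReal.ofReal_mul (by positivity)]
  · congr 1; ring
  · have h3 : Set.Ioi y = Set.Ioi y ∩ Set.Ioi 0 := by
      rw [Set.Ioi_inter_Ioi, max_eq_left hy]
    rw [h3]
    exact Ioi_ae_eq_Ici.symm.inter (ae_eq_refl _)

lemma laplace_measure_Iic {V : Measure ℝ} [SFinite V] (hV : V (Set.Iio 0) = 0)
    (hVfin : ∀ x, V (Set.Iic x) < ⊤) {β F : ℝ} (hβ : 0 < β) (hF : 0 ≤ F)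
    (hVF : ∫⁻ x, ENNReal.ofReal (Real.exp (-β * x)) ∂V = ENNReal.ofReal F) :
    IntegrableOn (fun x => Real.exp (-β * x) * (V (Set.Iic x)).toReal) (Set.Ioi 0) ∧
      ∫ x in Set.Ioi 0, Real.exp (-β * x) * (V (Set.Iic x)).toReal = F / β := by
  have hmono : Monotone fun x => (V (Set.Iic x)).toReal := fun x y hxy =>
    ENNReal.toReal_mono (hVfin y).ne (measure_mono (Set.Iic_subset_Iic.2 hxy))
  have hmeas : Measurable fun x => Real.exp (-β * x) * (V (Set.Iic x)).toReal :=
    Measurable.mul (by fun_prop) hmono.measurable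
  have hnn : ∀ x, 0 ≤ Real.exp (-β * x) * (V (Set.Iic x)).toReal := fun x => by positivity
  have hL : ∫⁻ x in Set.Ioi 0, ENNReal.ofReal (Real.exp (-β * x) * (V (Set.Iic x)).toReal)
      = ENNReal.ofReal (F / β) := by
    have : ∀ x, ENNReal.ofReal (Real.exp (-β * x) * (V (Set.Iic x)).toReal)
        = ENNReal.ofReal (Real.exp (-β * x)) * V (Set.Iic x) := fun x => by
      rw [ENNReal.ofReal_mul (Real.exp_pos _).le, ENNReal.ofReal_toReal (hVfin x).ne]
    simp_rw [this]
    rw [lintegral_exp_mul_measure_Iic hV hβ, hVF, ← ENNReal.ofReal_mul (by positivity),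
      inv_mul_eq_div]
  refine ⟨(lintegral_ofReal_ne_top_iff_integrable hmeas.aestronglyMeasurable
    (ae_of_all _ hnn)).1 (by rw [hL]; exact ENNReal.ofReal_ne_top), ?_⟩
  rw [integral_eq_lintegral_of_nonneg_ae (ae_of_all _ hnn) hmeas.aestronglyMeasurable, hL,
    ENNReal.toReal_ofReal (div_nonneg hF hβ.le)]

/-- Right-continuous functions that agree almost everywhere on `(0, ∞)` agree on `[0, ∞)`. -/
lemma eq_of_ae_eq_of_rightContinuous {W₁ W₂ : ℝ → ℝ}
    (h₁ : ∀ x, 0 ≤ x → ContinuousWithinAt W₁ (Set.Ici x) x)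
    (h₂ : ∀ x, 0 ≤ x → ContinuousWithinAt W₂ (Set.Ici x) x)
    (h : ∀ᵐ x ∂(volume.restrict (Set.Ioi (0 : ℝ))), W₁ x = W₂ x) {x : ℝ} (hx : 0 ≤ x) :
    W₁ x = W₂ x := by
  by_contra hne
  have hev : ∀ᶠ y in 𝓝[>] x, W₁ y ≠ W₂ y :=
    (((h₁ x hx).mono Set.Ioi_subset_Ici_self).prodMk
      ((h₂ x hx).mono Set.Ioi_subset_Ici_self)).eventually
      (isOpen_ne_fun continuous_fst continuous_snd |>.mem_nhds hne)
  obtain ⟨y, hy, hsub⟩ := mem_nhdsGT_iff_exists_Ioo_subset.1 hev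
  have hnull : volume (Set.Ioo x y) = 0 := by
    rw [ae_restrict_iff' measurableSet_Ioi, ae_iff] at h
    refine measure_mono_null (fun z hz => ?_) h
    have h0 : (0 : ℝ) < z := hx.trans_lt hz.1
    simpa [h0] using hsub hz
  rw [Real.volume_Ioo, ENNReal.ofReal_eq_zero] at hnull
  have : x < y := hy
  linarith

/-- A right-continuous function `W ≥ 0` on `[0, ∞)` is determined by its Laplace transform on a
half-line `[b, ∞)`. -/
lemma eq_of_laplace_eq {W₁ W₂ : ℝ → ℝ} (hn₁ : ∀ x, 0 ≤ W₁ x) (hn₂ : ∀ x, 0 ≤ W₂ x)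
    (hz₁ : ∀ x, x < 0 → W₁ x = 0) (hz₂ : ∀ x, x < 0 → W₂ x = 0)
    (hr₁ : ∀ x, 0 ≤ x → ContinuousWithinAt W₁ (Set.Ici x) x)
    (hr₂ : ∀ x, 0 ≤ x → ContinuousWithinAt W₂ (Set.Ici x) x) {b : ℝ}
    (hi₁ : IntegrableOn (fun x => Real.exp (-b * x) * W₁ x) (Set.Ioi 0))
    (hi₂ : IntegrableOn (fun x => Real.exp (-b * x) * W₂ x) (Set.Ioi 0))
    (h : ∀ β, b ≤ β → ∫ x in Set.Ioi (0 : ℝ), Real.exp (-β * x) * W₁ x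
      = ∫ x in Set.Ioi (0 : ℝ), Real.exp (-β * x) * W₂ x) : W₁ = W₂ := by
  let ν : (ℝ → ℝ) → Measure ℝ := fun W => (volume.restrict (Set.Ioi (0 : ℝ))).withDensity
    fun x => ENNReal.ofReal (Real.exp (-b * x) * W x)
  have hf₁ : IsFiniteMeasure (ν W₁) := isFiniteMeasure_withDensity_ofReal hi₁.2
  have hf₂ : IsFiniteMeasure (ν W₂) := isFiniteMeasure_withDensity_ofReal hi₂.2
  have hν0 : ∀ W, ν W (Set.Iio 0) = 0 := fun W => by
    refine withDensity_absolutelyContinuous _ _ ?_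
    rw [Measure.restrict_apply measurableSet_Iio]
    convert measure_empty (μ := (volume : Measure ℝ))
    ext y; simp only [Set.mem_inter_iff, Set.mem_Iio, Set.mem_Ioi, Set.mem_empty_iff_false,
      iff_false]; intro h; linarith [h.1, h.2]
  have hν : ∀ W : ℝ → ℝ, (∀ x, 0 ≤ W x) →
      IntegrableOn (fun x => Real.exp (-b * x) * W x) (Set.Ioi 0) → ∀ n : ℕ,
      ∫ x, Real.exp (-n * x) ∂(ν W)
        = ∫ x in Set.Ioi (0 : ℝ), Real.exp (-(b + n) * x) * W x := by
    intro W hW hi n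
    rw [integral_withDensity_eq_integral_toReal_smul₀ hi.1.aemeasurable.ennreal_ofReal
      (ae_of_all _ fun x => ENNReal.ofReal_lt_top)]
    refine integral_congr_ae (ae_of_all _ fun x => ?_)
    simp only [smul_eq_mul]
    rw [ENNReal.toReal_ofReal (mul_nonneg (Real.exp_pos _).le (hW x)), mul_right_comm,
      ← Real.exp_add]
    congr 2; ring
  have heq : ν W₁ = ν W₂ := ext_of_laplace (hν0 _) (hν0 _) fun n => by
    rw [hν W₁ hn₁ hi₁, hν W₂ hn₂ hi₂]
    exact h _ (by simp)
  have hae := (withDensity_eq_iff hi₁.1.aemeasurable.ennreal_ofReal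
    hi₂.1.aemeasurable.ennreal_ofReal hi₁.lintegral_lt_top.ne).1 heq
  have hae' : ∀ᵐ x ∂(volume.restrict (Set.Ioi (0 : ℝ))), W₁ x = W₂ x := by
    filter_upwards [hae] with x hx
    have := (ENNReal.ofReal_eq_ofReal_iff (mul_nonneg (Real.exp_pos _).le (hn₁ x))
      (mul_nonneg (Real.exp_pos _).le (hn₂ x))).1 hx
    exact mul_left_cancel₀ (Real.exp_pos _).ne' this
  ext x
  rcases lt_or_ge x 0 with hx | hx
  · rw [hz₁ x hx, hz₂ x hx]
  · exact eq_of_ae_eq_of_rightContinuous hr₁ hr₂ hae' hx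

/-! ### The Laplace exponent -/

variable {Ω : Type*} {mΩ : MeasurableSpace Ω} {P : Measure Ω} {ℱ : Filtration ℝ≥0 mΩ}
  {X : ℝ≥0 → Ω → ℝ}

lemma _root_.IsLevyProcess.measurable (hX : IsLevyProcess X ℱ P) (t : ℝ≥0) : Measurable (X t) :=
  (hX.adapted t).mono (ℱ.le t) le_rfl

lemma exponentialMoment [IsProbabilityMeasure P] (hX : IsLevyProcess X ℱ P) {μ σ : ℝ}
    {L : Measure ℝ} (hT : HasLevyTriplet X P μ σ L) (hpos : L (Set.Ioi 0) = 0) {u : ℝ}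
    (hu : 0 ≤ u) (t : ℝ≥0) :
    Integrable (fun ω => Real.exp (u * X t ω)) P ∧
      ∫ ω, Real.exp (u * X t ω) ∂P = Real.exp (t * (complexExponent μ σ L u).re) := by
  have hm := hX.measurable t
  have hprob : IsProbabilityMeasure (P.map (X t)) :=
    Measure.isProbabilityMeasure_map hm.aemeasurable
  have h := lintegral_exp_of_charFun hT.levyMeasure hpos μ σ t (P.map (X t))
    (hT.charFun_eq t) hu
  rw [lintegral_map (by fun_prop) hm] at h
  have hmeas : Measurable fun ω => Real.exp (u * X t ω) := by fun_prop
  have hnn : ∀ ω, 0 ≤ Real.exp (u * X t ω) := fun ω => (Real.exp_pos _).le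
  refine ⟨(lintegral_ofReal_ne_top_iff_integrable hmeas.aestronglyMeasurable
    (ae_of_all _ hnn)).1 (by rw [h]; exact ENNReal.ofReal_ne_top), ?_⟩
  rw [integral_eq_lintegral_of_nonneg_ae (ae_of_all _ hnn) hmeas.aestronglyMeasurable, h,
    ENNReal.toReal_ofReal (Real.exp_pos _).le]

lemma laplaceExponent_eq [IsProbabilityMeasure P] (hX : IsLevyProcess X ℱ P) {μ σ : ℝ}
    {L : Measure ℝ} (hT : HasLevyTriplet X P μ σ L) (hpos : L (Set.Ioi 0) = 0) {u : ℝ}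
    (hu : 0 ≤ u) : laplaceExponent X P u = (complexExponent μ σ L u).re := by
  rw [laplaceExponent, cgf, mgf, (exponentialMoment hX hT hpos hu 1).2]
  simp

/-- The cumulant generating function of a random variable with all positive exponential moments is
continuous on `[0, ∞)`, including right continuity at `0`, the edge of its domain. -/
lemma continuousOn_cgf [IsProbabilityMeasure P] {Y : Ω → ℝ} (hY : Measurable Y)
    (hint : ∀ u, 0 ≤ u → Integrable (fun ω => Real.exp (u * Y ω)) P) :
    ContinuousOn (cgf Y P) (Set.Ici 0) := by
  refine ContinuousOn.log ?_ fun u hu => (mgf_pos (hint u hu)).ne'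
  intro u hu
  have hu' : (0 : ℝ) ≤ u := hu
  refine continuousWithinAt_of_dominated (bound := fun ω => 1 + Real.exp ((u + 1) * Y ω))
    (Eventually.of_forall fun v => Measurable.aestronglyMeasurable (by fun_prop)) ?_
    ((integrable_const _).add (hint (u + 1) (by linarith))) (ae_of_all _ fun ω => ?_)
  · have hev : ∀ᶠ v in 𝓝[Set.Ici 0] u, v < u + 1 :=
      nhdsWithin_le_nhds (eventually_lt_nhds (by linarith))
    filter_upwards [hev, self_mem_nhdsWithin] with v hv hv0
    refine ae_of_all _ fun ω => ?_
    have hv0' : (0 : ℝ) ≤ v := hv0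
    rw [Real.norm_of_nonneg (Real.exp_pos _).le]
    rcases le_total (Y ω) 0 with h | h
    · have := Real.exp_le_one_iff.2 (mul_nonpos_of_nonneg_of_nonpos hv0' h)
      linarith [Real.exp_pos ((u + 1) * Y ω)]
    · have : Real.exp (v * Y ω) ≤ Real.exp ((u + 1) * Y ω) :=
        Real.exp_le_exp.2 (mul_le_mul_of_nonneg_right hv.le h)
      linarith
  · exact Continuous.continuousWithinAt (by fun_prop)

/-- By Jensen's inequality, `cgf u / u` is nondecreasing. -/
lemma mul_cgf_le_cgf_mul [IsProbabilityMeasure P] {Y : Ω → ℝ}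
    (hint : ∀ u, 0 ≤ u → Integrable (fun ω => Real.exp (u * Y ω)) P) {u p : ℝ} (hu : 0 ≤ u)
    (hp : 1 ≤ p) : p * cgf Y P u ≤ cgf Y P (p * u) := by
  have hfun : ∀ ω, Real.exp (p * u * Y ω) = Real.exp (u * Y ω) ^ p := fun ω => by
    rw [← Real.exp_mul]; congr 1; ring
  have hpu : Integrable (fun ω => Real.exp (u * Y ω) ^ p) P := by
    simpa only [← hfun] using hint (p * u) (by positivity)
  have hj := (convexOn_rpow hp).map_integral_le
    (Real.continuous_rpow_const (by linarith)).continuousOn isClosed_Ici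
    (ae_of_all P fun ω => (Real.exp_pos (u * Y ω)).le) (hint u hu) hpu
  have hpos : 0 < mgf Y P u := mgf_pos (hint u hu)
  rw [cgf, cgf, ← Real.log_rpow hpos]
  refine Real.log_le_log (Real.rpow_pos_of_pos hpos p) ?_
  simpa only [mgf, hfun] using hj

/-- If `mgf ≤ 1` on `[0, ∞)`, then the variable is almost surely nonpositive, by Chernoff's
bound. -/
lemma ae_nonpos_of_mgf_le_one [IsProbabilityMeasure P] {Y : Ω → ℝ}
    (hint : ∀ u, 0 ≤ u → Integrable (fun ω => Real.exp (u * Y ω)) P)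
    (hmgf : ∀ u, 0 ≤ u → mgf Y P u ≤ 1) : ∀ᵐ ω ∂P, Y ω ≤ 0 := by
  have hk : ∀ k : ℕ, ∀ᵐ ω ∂P, Y ω < 1 / ((k : ℝ) + 1) := by
    intro k
    set ε : ℝ := 1 / ((k : ℝ) + 1) with hε
    have hε0 : 0 < ε := by positivity
    have hle : ∀ u : ℕ, P.real {ω | ε ≤ Y ω} ≤ Real.exp (-ε) ^ u := by
      intro u
      refine (measure_ge_le_exp_mul_mgf ε (Nat.cast_nonneg u) (hint u (Nat.cast_nonneg u))).trans ?_
      refine (mul_le_of_le_one_right (Real.exp_pos _).le (hmgf u (Nat.cast_nonneg u))).trans_eq ?_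
      rw [← Real.exp_nat_mul]; congr 1; ring
    have hlim : Tendsto (fun u : ℕ => Real.exp (-ε) ^ u) atTop (𝓝 0) :=
      tendsto_pow_atTop_nhds_zero_of_lt_one (Real.exp_pos _).le
        (by rw [Real.exp_lt_one_iff]; linarith)
    have h0 : P.real {ω | ε ≤ Y ω} = 0 :=
      le_antisymm (ge_of_tendsto' hlim hle) measureReal_nonneg
    rw [ae_iff]
    simpa [not_lt] using (measureReal_eq_zero_iff).1 h0
  filter_upwards [ae_all_iff.2 hk] with ω hω
  exact ge_of_tendsto' tendsto_one_div_add_atTop_nhds_zero_nat fun k => (hω k).le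

/-- A right-continuous function on `ℝ≥0` is antitone if it is so along a dense set. -/
lemma antitone_of_dense {f : ℝ≥0 → ℝ} (hf : ∀ t, ContinuousWithinAt f (Set.Ici t) t)
    {D : Set ℝ≥0} (hD : Dense D) (h : ∀ r ∈ D, ∀ s ∈ D, r ≤ s → f s ≤ f r) : Antitone f := by
  intro s t hst
  by_contra! hlt
  have hne : s < t := lt_of_le_of_ne hst fun h => by simp [h] at hlt
  obtain ⟨c, hc1, hc2⟩ := exists_between hlt
  have hs : ∀ᶠ r in 𝓝[>] s, f r < c :=
    ((hf s).mono Set.Ioi_subset_Ici_self).eventually_lt_const hc1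
  have ht : ∀ᶠ r in 𝓝[>] t, c < f r :=
    ((hf t).mono Set.Ioi_subset_Ici_self).eventually_const_lt hc2
  obtain ⟨s', hs', hs''⟩ := mem_nhdsGT_iff_exists_Ioo_subset.1
    (hs.and (nhdsWithin_le_nhds (eventually_lt_nhds hne)))
  obtain ⟨t', ht', ht''⟩ := mem_nhdsGT_iff_exists_Ioo_subset.1 ht
  obtain ⟨r, hrD, hr⟩ := hD.exists_between hs'
  obtain ⟨r', hrD', hr'⟩ := hD.exists_between ht'
  have h1 := hs'' hr
  have h2 := ht'' hr'
  have h3 := h r hrD r' hrD' (h1.2.trans hr'.1).le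
  exact absurd (h2.trans_le h3) (not_lt.2 h1.1.le)

/-- The Laplace exponent is positive somewhere: otherwise every increment is nonpositive and the
paths are decreasing. -/
lemma exists_laplaceExponent_pos [IsProbabilityMeasure P] (hX : IsLevyProcess X ℱ P)
    (hdec : ¬ ∀ᵐ ω ∂P, Antitone (fun t => X t ω))
    (hexp : ∀ u : ℝ, 0 ≤ u → ∀ t : ℝ≥0, Integrable (fun ω => Real.exp (u * X t ω)) P ∧
        ∫ ω, Real.exp (u * X t ω) ∂P = Real.exp (laplaceExponent X P u * t)) :
    ∃ u, 0 ≤ u ∧ 0 < laplaceExponent X P u := by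
  by_contra! hle
  refine hdec ?_
  have hneg : ∀ t, ∀ᵐ ω ∂P, X t ω ≤ 0 := by
    intro t
    refine ae_nonpos_of_mgf_le_one (fun u hu => (hexp u hu t).1) fun u hu => ?_
    rw [mgf, (hexp u hu t).2]
    exact Real.exp_le_one_iff.2 (mul_nonpos_of_nonpos_of_nonneg (hle u hu) t.2)
  have hinc : ∀ s t, s ≤ t → ∀ᵐ ω ∂P, X t ω ≤ X s ω := by
    intro s t hst
    have h := (hX.stationary_increment s t hst).symm.ae_snd (p := fun x => x ≤ 0)
      measurableSet_Iic (hneg (t - s))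
    filter_upwards [h] with ω hω
    linarith
  let D : ℕ → ℝ≥0 := TopologicalSpace.denseSeq ℝ≥0
  have hall : ∀ᵐ ω ∂P, ∀ i j, D i ≤ D j → X (D j) ω ≤ X (D i) ω := by
    refine ae_all_iff.2 fun i => ae_all_iff.2 fun j => ?_
    by_cases h : D i ≤ D j
    · exact (hinc _ _ h).mono fun ω hω _ => hω
    · exact ae_of_all _ fun ω h' => absurd h' h
  filter_upwards [hall, hX.cadlag] with ω h1 h2
  refine antitone_of_dense (fun t => (h2 t).1) (TopologicalSpace.denseRange_denseSeq ℝ≥0) ?_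
  rintro _ ⟨i, rfl⟩ _ ⟨j, rfl⟩ hij
  exact h1 i j hij

/-- For a continuous `f` on `[0, ∞)` with `f 0 ≤ q` that tends to infinity, the equation `f = q` has
a largest root, and `f > q` to the right of it. -/
lemma isGreatest_sSup_root {f : ℝ → ℝ} (hf : ContinuousOn f (Set.Ici 0)) {q : ℝ} (h0 : f 0 ≤ q)
    (hlim : Tendsto f atTop atTop) :
    IsGreatest {u | 0 ≤ u ∧ f u = q} (sSup {u | 0 ≤ u ∧ f u = q}) ∧
      ∀ β, sSup {u | 0 ≤ u ∧ f u = q} < β → q < f β := by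
  have hroot : ∀ a, 0 ≤ a → f a ≤ q → ∃ u, a ≤ u ∧ f u = q := by
    intro a ha hfa
    obtain ⟨K, hK, haK⟩ := ((hlim.eventually_gt_atTop q).and (eventually_ge_atTop a)).exists
    obtain ⟨u, hu, hfu⟩ := intermediate_value_Icc haK
      (hf.mono fun x hx => ha.trans hx.1) ⟨hfa, hK.le⟩
    exact ⟨u, hu.1, hfu⟩
  have hne : {u | 0 ≤ u ∧ f u = q}.Nonempty := hroot 0 le_rfl h0
  have hbdd : BddAbove {u | 0 ≤ u ∧ f u = q} := by
    obtain ⟨K, hK⟩ := eventually_atTop.1 (hlim.eventually_gt_atTop q)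
    refine ⟨K, fun u hu => ?_⟩
    by_contra! h
    exact absurd (hK u h.le) (by simp [hu.2])
  have hclosed : IsClosed {u | 0 ≤ u ∧ f u = q} :=
    hf.preimage_isClosed_of_isClosed isClosed_Ici isClosed_singleton
  have hmem := hclosed.csSup_mem hne hbdd
  refine ⟨⟨hmem, fun u hu => le_csSup hbdd hu⟩, fun β hβ => ?_⟩
  by_contra! h
  have hβ0 : 0 ≤ β := hmem.1.trans hβ.le
  obtain ⟨u, hu, hfu⟩ := hroot β hβ0 h
  exact absurd (le_csSup hbdd ⟨hβ0.trans hu, hfu⟩) (not_le.2 (hβ.trans_le hu))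

/-! ### Scale functions -/

/-- A function with the properties of the `q`-scale function, except that the Laplace transform is
only prescribed on `[b, ∞)`. -/
lemma exists_scaleFunction_of_le [IsProbabilityMeasure P] (hX : IsLevyProcess X ℱ P) {μ σ : ℝ}
    {L : Measure ℝ} (hT : HasLevyTriplet X P μ σ L) (hpos : L (Set.Ioi 0) = 0)
    (hcont : ContinuousOn (laplaceExponent X P) (Set.Ici 0)) {q b : ℝ} (hq : 0 ≤ q) (hb : 0 < b)
    (hbq : ∀ β, b ≤ β → q < laplaceExponent X P β) :
    ∃ W : ℝ → ℝ, (∀ x, 0 ≤ W x) ∧ (∀ x, x < 0 → W x = 0) ∧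
      (∀ x, 0 ≤ x → ContinuousWithinAt W (Set.Ici x) x) ∧ ∀ β, b ≤ β →
      IntegrableOn (fun x => Real.exp (-β * x) * W x) (Set.Ioi 0) volume ∧
      ∫ x in Set.Ioi (0 : ℝ), Real.exp (-β * x) * W x = 1 / (laplaceExponent X P β - q) := by
  have hfin := isFiniteMeasure_approxMeasure hT.levyMeasure σ
  have hκ : ∀ β, b ≤ β → Tendsto (fun n => realJumpExponent (approxDrift μ σ L n)
      (approxMeasure σ L n) β) atTop (𝓝 (laplaceExponent X P β)) := by
    intro β hβ
    rw [laplaceExponent_eq hX hT hpos (hb.le.trans hβ)]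
    exact tendsto_realJumpExponent_approx hT.levyMeasure hpos μ σ (hb.le.trans hβ)
  obtain ⟨N, hN⟩ := eventually_atTop.1 ((hκ b le_rfl).eventually_const_lt (hbq b le_rfl))
  choose U hU0 hU using fun n => exists_scaleMeasure_of_jumpExponent hq
    (approxMeasure σ L (n + N)) (approxMeasure_Ici_zero σ L (n + N))
    (approxDrift μ σ L (n + N)) hb (hN (n + N) (Nat.le_add_left _ _))
  obtain ⟨V, hVs, hV0, hV⟩ := exists_measure_of_tendsto_laplace hU0 hU
    (F₀ := fun β => β / (laplaceExponent X P β - q))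
    (fun β hβ => tendsto_const_nhds.div
      (((hκ β hβ).comp (tendsto_add_atTop_nat N)).sub_const q) (by linarith [hbq β hβ]))
    (continuousWithinAt_id.div (((hcont b hb.le).mono (Set.Ici_subset_Ici.2 hb.le)).sub
      continuousWithinAt_const) (by linarith [hbq b le_rfl]))
  have hVfin := measure_Iic_lt_top_of_laplace hb ((hV b le_rfl).trans_lt ENNReal.ofReal_lt_top)
  refine ⟨fun x => (V (Set.Iic x)).toReal, fun x => ENNReal.toReal_nonneg, fun x hx => ?_,
    fun x _ => continuousWithinAt_measure_Iic hVfin x, fun β hβ => ?_⟩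
  · have hnull : V (Set.Iic x) = 0 := measure_mono_null (Set.Iic_subset_Iio.2 hx) hV0
    simp only [hnull, ENNReal.toReal_zero]
  · have hβ0 : 0 < β := hb.trans_le hβ
    have hden : 0 < laplaceExponent X P β - q := by linarith [hbq β hβ]
    have h := laplace_measure_Iic hV0 hVfin hβ0 (div_nonneg hβ0.le hden.le) (hV β hβ)
    refine ⟨h.1, h.2.trans ?_⟩
    field_simp

end LevyScale

open LevyScale in
/-- For a spectrally negative Lévy process the Laplace exponent `ψ` is well defined on `[0, ∞)`,
and for every `q ≥ 0` the largest root `Φ(q)` of `ψ = q` is well defined and the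
`q`-scale function exists (and is the unique function with its defining properties). -/
theorem theorem2p1 {Ω : Type*} {mΩ : MeasurableSpace Ω} (P : Measure Ω)
    [IsProbabilityMeasure P] (ℱ : Filtration ℝ≥0 mΩ) (X : ℝ≥0 → Ω → ℝ)
    (hX : IsSpectrallyNegativeLevyProcess X ℱ P) :
    (∀ u : ℝ, 0 ≤ u → ∀ t : ℝ≥0,
      Integrable (fun ω => Real.exp (u * X t ω)) P ∧
        ∫ ω, Real.exp (u * X t ω) ∂P = Real.exp (laplaceExponent X P u * t)) ∧
    ∀ q : ℝ, 0 ≤ q →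
      IsGreatest {u : ℝ | 0 ≤ u ∧ laplaceExponent X P u = q} (laplaceExponentInverse X P q) ∧
      ∃! W : ℝ → ℝ, IsScaleFunction X P q W := by
  obtain ⟨μ, σ, L, hT, hpos⟩ := hX.no_positive_jumps
  have hLevy := hX.isLevy
  have hexp : ∀ u : ℝ, 0 ≤ u → ∀ t : ℝ≥0,
      Integrable (fun ω => Real.exp (u * X t ω)) P ∧
        ∫ ω, Real.exp (u * X t ω) ∂P = Real.exp (laplaceExponent X P u * t) := by
    intro u hu t
    rw [laplaceExponent_eq hLevy hT hpos hu, mul_comm]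
    exact exponentialMoment hLevy hT hpos hu t
  refine ⟨hexp, fun q hq => ?_⟩
  have hint : ∀ u, 0 ≤ u → Integrable (fun ω => Real.exp (u * X 1 ω)) P :=
    fun u hu => (hexp u hu 1).1
  have hcont : ContinuousOn (laplaceExponent X P) (Set.Ici 0) :=
    continuousOn_cgf (hLevy.measurable 1) hint
  have hzero : laplaceExponent X P 0 = 0 := cgf_zero
  have hlim : Tendsto (laplaceExponent X P) atTop atTop := by
    obtain ⟨u, hu, hψu⟩ := exists_laplaceExponent_pos hLevy hX.not_decreasing hexp
    have hu0 : 0 < u := lt_of_le_of_ne hu fun h => by rw [← h, hzero] at hψu; exact hψu.false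
    refine tendsto_atTop_mono' atTop ?_
      (tendsto_id.atTop_mul_const (div_pos hψu hu0))
    filter_upwards [eventually_ge_atTop u] with v hv
    have h := mul_cgf_le_cgf_mul hint hu ((one_le_div hu0).2 hv)
    rw [div_mul_cancel₀ _ hu0.ne'] at h
    calc id v * (laplaceExponent X P u / u) = v / u * cgf (X 1) P u := by
          rw [laplaceExponent, id]; ring
      _ ≤ laplaceExponent X P v := h
  obtain ⟨hgreat, hright⟩ := isGreatest_sSup_root hcont (hzero.trans_le hq) hlim
  refine ⟨hgreat, ?_⟩
  have hΦ : 0 ≤ laplaceExponentInverse X P q := hgreat.1.1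
  have hex : ∀ b, laplaceExponentInverse X P q < b → _ := fun b hb =>
    exists_scaleFunction_of_le hLevy hT hpos hcont hq (hΦ.trans_lt hb)
      fun β hβ => hright β (lt_of_lt_of_le hb hβ)
  obtain ⟨W, hWn, hWz, hWr, hW⟩ := hex (laplaceExponentInverse X P q + 1) (lt_add_one _)
  -- the function does not depend on the half-line used to construct it
  have hall : ∀ β, laplaceExponentInverse X P q < β →
      IntegrableOn (fun x => Real.exp (-β * x) * W x) (Set.Ioi 0) volume ∧
      ∫ x in Set.Ioi (0 : ℝ), Real.exp (-β * x) * W x = 1 / (laplaceExponent X P β - q) := by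
    intro β hβ
    obtain ⟨W', hWn', hWz', hWr', hW'⟩ := hex β hβ
    have heq : W = W' := by
      refine eq_of_laplace_eq hWn hWn' hWz hWz' hWr hWr'
        (b := max β (laplaceExponentInverse X P q + 1)) (hW _ (le_max_right _ _)).1
        (hW' _ (le_max_left _ _)).1 fun β' hβ' => ?_
      rw [(hW β' ((le_max_right _ _).trans hβ')).2, (hW' β' ((le_max_left _ _).trans hβ')).2]
    rw [heq]
    exact hW' β le_rfl
  refine ⟨W, ⟨hWn, hWz, hWr, fun β hβ => (hall β hβ).1, fun β hβ => (hall β hβ).2⟩, ?_⟩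
  intro W' hW'
  have hlt := lt_add_one (laplaceExponentInverse X P q)
  refine eq_of_laplace_eq hW'.nonneg hWn hW'.eq_zero hWz hW'.right_continuous hWr
    (hW'.integrable _ hlt) (hall _ hlt).1 fun β hβ => ?_
  rw [hW'.laplace_eq β (hlt.trans_le hβ), (hall β (hlt.trans_le hβ)).2]
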